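/- Let $\mathbb{H}$ be the quaternions. Let $\mathbb{H}_d[z,w]$ be the set of functions on $\mathbb{H}^2$ that are finite sums of monomials $a_0x_1a_1x_2\cdots x_da_d$ with $a_0,\dots,a_d\in\mathbb{H}$ and each $x_k\in\{z,w\}$, and let $\mathcal{H}[z,w]$ be the set of functions $f:\mathbb{H}^2\to\mathbb{H}$ of the form $f=\sum_{d\ge 0}f_d$ with $f_d\in\mathbb{H}_d[z,w]$, the series converging absolutely at every point of $\mathbb{H}^2$. A vector field is a map $X=(f,g)$ with $f,g\in\mathcal{H}[z,w]$. For $h\in\mathbb{H}$ put $$\mathrm{Div}X(z,w)[h]=\widehat\partial_zf(z,w)[h]+\widehat\partial_wg(z,w)[h],$$ where $\widehat\partial_z f(z,w)[\cdot]$ and $\widehat\partial_w f(z,w)[\cdot]$ are the real partial differentials of $f$ in $z$ and in $w$. The field $X$ has divergence if there is a function $\operatorname{div}X:\mathbb{H}^2\to\mathbb{H}$ with $\mathrm{Div}X(z,w)[h]=h\operatorname{div}X(z,w)$ for all $z,w,h$; it has divergence zero if $\mathrm{Div}X(z,w)[h]=0$ for all $z,w,h$. A flow of $X$ is a map $\Phi^X:D\to\mathbb{H}^2$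 with $\frac{d}{dt}\Phi^X(z,w,t)=X(\Phi^X(z,w,t))$ on $D$ and $\Phi^X(z,w,0)=(z,w)$, where $D\subset\mathbb{H}^2\times\mathbb{R}$ is open and $\{t:(z,w,t)\in D\}$ is an interval containing $0$ for every $(z,w)$. Let $\mathrm{Aut}_V(\mathbb{H}^2)$ (automorphisms with volume) be the set of time-one maps $(z,w)\mapsto\Phi^X(z,w,1)$ of flows, with $\mathbb{H}^2\times\{1\}\subset D$, of vector fields $X$ with divergence, and let $\mathrm{Aut}_1(\mathbb{H}^2)$ (automorphisms with volume $1$) be the set of those for which $X$ has divergence zero. A function $f:\mathbb{H}\to\mathbb{H}$ is slice-regular if $f(q)=\sum_{n\ge 0}q^na_n$ with $a_n\in\mathbb{H}$, convergent for all $q\in\mathbb{H}$. Let $\Lambda(z,w)=\alpha z+\beta w$ with $\alpha,\beta\in\mathbb{R}$, let $(v_1,v_2)\in\mathbb{R}^2$ with $v_1^2+v_2^2=1$ and $\alpha v_1+\beta v_2=0$, and let $f$ be slice-regular. The map $$(z,w)\mapsto(z,w)+(v_1,v_2)f(\Lambda(z,w))$$ is called a shear, and the map $$(z,w)\mapsto(z,w)+(v_1,v_2)(v_1z+v_2w)\bigl(e^{f(\Lambda(z,w))}-1\bigr)$$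 an overshear, where $e^q=\sum_{n\ge 0}q^n/n!$. Theorem. Every map in $\mathrm{Aut}_V(\mathbb{H}^2)$ can be approximated uniformly on compact sets by finite compositions of shears and overshears. Every map in $\mathrm{Aut}_1(\mathbb{H}^2)$ can be approximated uniformly on compact sets by finite compositions of shears. -/

import Mathlib

open scoped Quaternion

noncomputable section

/-- The space `ℍ²` of pairs `(z, w)` of quaternions. -/
abbrev QuatPlane : Type := ℍ[ℝ] × ℍ[ℝ]

/-- The non-commutative monomial `a * x₁ * a₁ * x₂ * a₂ * ⋯ * x_d * a_d` as a function on `ℍ²`.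
The list has `d` entries; the `k`-th entry records whether `x_k` is `z` (`true`) or `w` (`false`),
together with the quaternion `a_k`. -/
def quatMonomial (a : ℍ[ℝ]) (l : List (Bool × ℍ[ℝ])) (p : QuatPlane) : ℍ[ℝ] :=
  a * (l.map fun s => (if s.1 then p.1 else p.2) * s.2).prod

/-- `ℍ_d[z, w]`: finite sums of monomials of degree `d`. -/
def homogeneousPoly (d : ℕ) : Submodule ℝ (QuatPlane → ℍ[ℝ]) :=
  Submodule.span ℝ {m | ∃ a l, l.length = d ∧ m = quatMonomial a l}

/-- The class `𝓗[z, w]` of functions on `ℍ²` with an expansion `f = ∑ f_d`, `f_d ∈ ℍ_d[z, w]`,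
that converges absolutely on all of `ℍ²`. -/
def quatSeries : Set (QuatPlane → ℍ[ℝ]) :=
  {f | ∃ F : ℕ → QuatPlane → ℍ[ℝ], (∀ d, F d ∈ homogeneousPoly d) ∧
    ∀ p, Summable (fun d => ‖F d p‖) ∧ HasSum (fun d => F d p) (f p)}

/-- Vector fields `X = (f, g)` on `ℍ²` with `f, g ∈ 𝓗[z, w]`. -/
def quatVectorFields : Set (QuatPlane → QuatPlane) :=
  {X | (fun p => (X p).1) ∈ quatSeries ∧ (fun p => (X p).2) ∈ quatSeries}

/-- The partial derivative `h ↦ ∂̂_z f (z, w)[h]`: the real-linear map with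
`f (z + h, w) - f (z, w) = ∂̂_z f (z, w)[h] + o(‖h‖)`. -/
def partialZ (f : QuatPlane → ℍ[ℝ]) (p : QuatPlane) : ℍ[ℝ] →L[ℝ] ℍ[ℝ] :=
  fderiv ℝ (fun z => f (z, p.2)) p.1

/-- The partial derivative `h ↦ ∂̂_w f (z, w)[h]`. -/
def partialW (f : QuatPlane → ℍ[ℝ]) (p : QuatPlane) : ℍ[ℝ] →L[ℝ] ℍ[ℝ] :=
  fderiv ℝ (fun w => f (p.1, w)) p.2

/-- The operator `Div X (z, w)[h] = ∂̂_z f (z, w)[h] + ∂̂_w g (z, w)[h]` for `X = (f, g)`. -/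
def quatDiv (X : QuatPlane → QuatPlane) (p : QuatPlane) (h : ℍ[ℝ]) : ℍ[ℝ] :=
  partialZ (fun q => (X q).1) p h + partialW (fun q => (X q).2) p h

/-- `X` has divergence: `Div X (z, w)[h] = h * div X (z, w)` for some function `div X`. -/
def HasQuatDivergence (X : QuatPlane → QuatPlane) : Prop :=
  ∃ δ : QuatPlane → ℍ[ℝ], ∀ p h, quatDiv X p h = h * δ p

/-- `Φ` is a flow of `X` on the open set `D ⊆ ℍ² × ℝ`. For every point the set of times at which
the flow is defined is an interval containing `0`. -/
structure IsQuatFlow (X : QuatPlane → QuatPlane) (D : Set (QuatPlane × ℝ))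
    (Φ : QuatPlane × ℝ → QuatPlane) : Prop where
  isOpen : IsOpen D
  zero_mem : ∀ p, (p, (0 : ℝ)) ∈ D
  interval : ∀ p, Set.OrdConnected {t : ℝ | (p, t) ∈ D}
  initial : ∀ p, Φ (p, 0) = p
  deriv : ∀ p t, (p, t) ∈ D → HasDerivAt (fun s => Φ (p, s)) (X (Φ (p, t))) t

/-- `F` is the time-one map, defined on all of `ℍ²`, of a flow of `X`. -/
def IsTimeOneMap (X F : QuatPlane → QuatPlane) : Prop :=
  ∃ D Φ, IsQuatFlow X D Φ ∧ (∀ p, (p, (1 : ℝ)) ∈ D) ∧ ∀ p, F p = Φ (p, 1)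

/-- `Aut_V(ℍ²)`, the automorphisms with volume: time-one maps of vector fields with divergence. -/
def AutV : Set (QuatPlane → QuatPlane) :=
  {F | ∃ X ∈ quatVectorFields, HasQuatDivergence X ∧ IsTimeOneMap X F}

/-- `Aut_1(ℍ²)`, the automorphisms with volume `1`: time-one maps of vector fields with
divergence zero. -/
def Aut1 : Set (QuatPlane → QuatPlane) :=
  {F | ∃ X ∈ quatVectorFields, (∀ p h, quatDiv X p h = 0) ∧ IsTimeOneMap X F}

/-- Slice-regular functions on `ℍ`: `f q = ∑ qⁿ aₙ`, convergent on all of `ℍ`. -/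
def SliceRegular (f : ℍ[ℝ] → ℍ[ℝ]) : Prop :=
  ∃ a : ℕ → ℍ[ℝ], ∀ q, HasSum (fun n => q ^ n * a n) (f q)

/-- Shears `(z, w) ↦ (z, w) + (v₁, v₂) f(Λ(z, w))` with `f` slice-regular,
`Λ(z, w) = α z + β w` for real `α, β`, and `(v₁, v₂)` a real unit vector in the kernel of `Λ`. -/
def shears : Set (QuatPlane → QuatPlane) :=
  {S | ∃ (α β v₁ v₂ : ℝ) (f : ℍ[ℝ] → ℍ[ℝ]), α * v₁ + β * v₂ = 0 ∧ v₁ ^ 2 + v₂ ^ 2 = 1 ∧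
    SliceRegular f ∧ ∀ z w : ℍ[ℝ], S (z, w) =
      (z + v₁ • f (α • z + β • w), w + v₂ • f (α • z + β • w))}

/-- Overshears `(z, w) ↦ (z, w) + (v₁, v₂) (v₁ z + v₂ w) (e^{f(Λ(z, w))} - 1)` with `f`, `Λ` and
`(v₁, v₂)` as for shears. -/
def overshears : Set (QuatPlane → QuatPlane) :=
  {S | ∃ (α β v₁ v₂ : ℝ) (f : ℍ[ℝ] → ℍ[ℝ]), α * v₁ + β * v₂ = 0 ∧ v₁ ^ 2 + v₂ ^ 2 = 1 ∧
    SliceRegular f ∧ ∀ z w : ℍ[ℝ], S (z, w) =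
      (z + v₁ • ((v₁ • z + v₂ • w) * (NormedSpace.exp (f (α • z + β • w)) - 1)),
       w + v₂ • ((v₁ • z + v₂ • w) * (NormedSpace.exp (f (α • z + β • w)) - 1)))}

/-- Finite compositions of members of a set of self-maps of `ℍ²`. -/
def finiteCompositions (S : Set (QuatPlane → QuatPlane)) : Set (QuatPlane → QuatPlane) :=
  {G | ∃ l : List (QuatPlane → QuatPlane), (∀ s ∈ l, s ∈ S) ∧ G = l.foldr (· ∘ ·) id}

/-- `F` can be approximated by members of `C` uniformly on compact sets. -/
def ApproxOnCompacts (F : QuatPlane → QuatPlane) (C : Set (QuatPlane → QuatPlane)) : Prop :=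
  ∀ K : Set QuatPlane, IsCompact K → ∀ ε > 0, ∃ G ∈ C, ∀ p ∈ K, ‖F p - G p‖ < ε

end

/-! Call a field generated by a monoid `G` of maps if members of `G` match its Euler step up to
`o(h)`, uniformly on compact sets. Iterating such members is a perturbed Euler scheme, so it
converges to the time-one map (`InfGen.approx_timeOne`). It therefore suffices to show that the
given field is generated. The continuous fields generated with both signs form a linear space
(`genFields`), closed under locally uniform limits and under conjugation by linear maps that lie in
`G` together with their inverses.

Reduction to polynomials: pointwise absolute convergence of a series of homogeneous polynomial maps
already forces geometric bounds on balls (`exists_bound_unit_ball`), by a measure argument and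
Lagrange interpolation. Hence the sum is differentiable and locally Lipschitz, its partial sums
converge locally uniformly, and vanishing real divergence passes to each homogeneous term.

Shears: a polynomial field of zero real divergence is a sum of fields `ℓ(x)^d e` with `ℓ(e) = 0`
(`mem_linearShearFields_of_realDiv_eq_zero`). Translating the quadratic shear `q² a` produces `q ↦ c
q a`, hence every real-linear shear, so conjugation by real-linear maps is available. Conjugating
the fields `(wⁿ a, 0)` and passing to degenerate limits gives every `ℓ(x)^d e`
(`linearShearFields_le_genFields`).

Overshears: they generate fields with divergence `4 Re(wⁿ a)`, so up to a divergence-free field they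
give the radial field `Re(wⁿ a) p`. Conjugation and limits then give all `H(p) p`, and subtracting a
suitable one kills the divergence of any homogeneous field (`hPoly_le_genFields`). -/

/-! ### Infinitesimally generated vector fields. -/

section Infinitesimal

open Filter Topology

/-- A set of self-maps that contains the identity and is closed under composition. -/
structure IsMapMonoid {E : Type*} (G : Set (E → E)) : Prop where
  id_mem : id ∈ G
  comp_mem : ∀ {f g : E → E}, f ∈ G → g ∈ G → f ∘ g ∈ G

variable {E : Type*} [NormedAddCommGroup E] [NormedSpace ℝ E]

/-- `X` is infinitesimally generated by `G`: members of `G` agree with `p ↦ p + h X(p)` up to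
`o(h)` as `h → 0+`, uniformly on compact sets. -/
def InfGen (G : Set (E → E)) (X : E → E) : Prop :=
  ∀ K : Set E, IsCompact K → ∀ δ > 0, ∀ᶠ h : ℝ in 𝓝[>] 0, ∃ g ∈ G, ∀ p ∈ K,
    ‖g p - (p + h • X p)‖ ≤ δ * h

theorem InfGen.zero {G : Set (E → E)} (hG : IsMapMonoid G) : InfGen G 0 := by
  intro K _ δ hδ
  filter_upwards [self_mem_nhdsWithin] with h hh
  have : 0 < h := hh
  exact ⟨id, hG.id_mem, fun p _ => by simp; positivity⟩

/-- Compose the two approximating maps. The cross term `h (X(g₂ p) - X p)` is `o(h)` by uniform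
continuity of `X` on a compact thickening of `K`, which contains `g₂ p` for small `h`. -/
theorem InfGen.add [ProperSpace E] {G : Set (E → E)} (hG : IsMapMonoid G) {X Y : E → E}
    (hXc : Continuous X) (hYc : Continuous Y) (hX : InfGen G X) (hY : InfGen G Y) :
    InfGen G (X + Y) := by
  intro K hK δ hδ
  have hK' : IsCompact (Metric.cthickening 1 K) := hK.cthickening
  have huc := Metric.uniformContinuousOn_iff.1
    (hK'.uniformContinuousOn_of_continuous hXc.continuousOn) (δ / 3) (by positivity)
  obtain ⟨η, hη, huc⟩ := huc
  obtain ⟨M, hM⟩ := hK.exists_bound_of_continuousOn hYc.continuousOn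
  have hsmall : ∀ᶠ h : ℝ in 𝓝[>] 0, δ / 3 * h + h * M < min 1 η := by
    have : Tendsto (fun h : ℝ => δ / 3 * h + h * M) (𝓝[>] 0) (𝓝 (δ / 3 * 0 + 0 * M)) := by
      apply Tendsto.mono_left _ nhdsWithin_le_nhds
      exact Continuous.tendsto (by fun_prop) _
    refine this.eventually_lt_const ?_
    simp [hη]
  filter_upwards [hX _ hK' (δ / 3) (by positivity), hY K hK (δ / 3) (by positivity), hsmall,
    self_mem_nhdsWithin] with h ⟨g₁, hg₁, h₁⟩ ⟨g₂, hg₂, h₂⟩ hs hpos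
  have hpos : 0 < h := hpos
  refine ⟨g₁ ∘ g₂, hG.comp_mem hg₁ hg₂, fun p hp => ?_⟩
  have hd : dist (g₂ p) p < min 1 η := by
    rw [dist_eq_norm]
    calc ‖g₂ p - p‖ = ‖(g₂ p - (p + h • Y p)) + h • Y p‖ := by congr 1; abel
      _ ≤ ‖g₂ p - (p + h • Y p)‖ + ‖h • Y p‖ := norm_add_le _ _
      _ ≤ δ / 3 * h + h * M := by
        rw [norm_smul, Real.norm_of_nonneg hpos.le]
        gcongr
        · exact h₂ p hp
        · exact hM p hp
      _ < _ := hs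
  have hmem : g₂ p ∈ Metric.cthickening 1 K :=
    Metric.mem_cthickening_of_dist_le _ p _ _ hp (hd.le.trans (min_le_left _ _))
  have hmem' : p ∈ Metric.cthickening 1 K := Metric.self_subset_cthickening _ hp
  have h3 : ‖X (g₂ p) - X p‖ ≤ δ / 3 := by
    rw [← dist_eq_norm]
    exact (huc _ hmem _ hmem' (hd.trans_le (min_le_right _ _))).le
  calc ‖(g₁ ∘ g₂) p - (p + h • (X + Y) p)‖
      = ‖(g₁ (g₂ p) - (g₂ p + h • X (g₂ p))) + (g₂ p - (p + h • Y p))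
          + h • (X (g₂ p) - X p)‖ := by
        congr 1; simp only [Function.comp, Pi.add_apply, smul_add, smul_sub]; abel
    _ ≤ δ / 3 * h + δ / 3 * h + h * (δ / 3) := by
        refine (norm_add₃_le).trans ?_
        rw [norm_smul, Real.norm_of_nonneg hpos.le]
        gcongr
        · exact h₁ _ hmem
        · exact h₂ p hp
    _ = δ * h := by ring

/-- Rescale time from `h` to `c h`. Only forward time is available, so negative scalars need a
separate assumption on `-X`. -/
theorem InfGen.smul {G : Set (E → E)} (hG : IsMapMonoid G) {X : E → E} (hX : InfGen G X)
    {c : ℝ} (hc : 0 ≤ c) : InfGen G (c • X) := by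
  rcases hc.eq_or_lt with rfl | hc
  · rw [zero_smul]; exact InfGen.zero hG
  intro K hK δ hδ
  have ht : Tendsto (fun h : ℝ => c * h) (𝓝[>] 0) (𝓝[>] 0) := by
    refine tendsto_nhdsWithin_iff.2 ⟨?_, ?_⟩
    · apply Tendsto.mono_left _ nhdsWithin_le_nhds
      have : Continuous (fun h : ℝ => c * h) := by fun_prop
      simpa using this.tendsto 0
    · filter_upwards [self_mem_nhdsWithin] with h hh
      exact mul_pos hc hh
  filter_upwards [ht.eventually (hX K hK (δ / c) (by positivity))] with h ⟨g, hg, h1⟩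
  refine ⟨g, hg, fun p hp => ?_⟩
  have := h1 p hp
  rw [Pi.smul_apply, smul_smul, mul_comm h c]
  refine this.trans (le_of_eq ?_)
  field_simp

theorem InfGen.of_approx {G : Set (E → E)} {X : E → E}
    (h : ∀ K : Set E, IsCompact K → ∀ ε > 0, ∃ Y, InfGen G Y ∧ ∀ p ∈ K, ‖X p - Y p‖ ≤ ε) :
    InfGen G X := by
  intro K hK δ hδ
  obtain ⟨Y, hY, hXY⟩ := h K hK (δ / 2) (by positivity)
  filter_upwards [hY K hK (δ / 2) (by positivity), self_mem_nhdsWithin] with h ⟨g, hg, h1⟩ hpos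
  have hpos : 0 < h := hpos
  refine ⟨g, hg, fun p hp => ?_⟩
  calc ‖g p - (p + h • X p)‖ = ‖(g p - (p + h • Y p)) - h • (X p - Y p)‖ := by
        congr 1; rw [smul_sub]; abel
    _ ≤ ‖g p - (p + h • Y p)‖ + ‖h • (X p - Y p)‖ := norm_sub_le _ _
    _ ≤ δ / 2 * h + h * (δ / 2) := by
        rw [norm_smul, Real.norm_of_nonneg hpos.le]
        gcongr
        · exact h1 p hp
        · exact hXY p hp
    _ = δ * h := by ring

theorem InfGen.conj {G : Set (E → E)} (hG : IsMapMonoid G) {X : E → E} (hX : InfGen G X)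
    (T : E ≃L[ℝ] E) (hT : ⇑T ∈ G) (hT' : ⇑T.symm ∈ G) :
    InfGen G (fun p => T (X (T.symm p))) := by
  intro K hK δ hδ
  have hK' : IsCompact (T.symm '' K) := hK.image T.symm.continuous
  set C : ℝ := ‖(T : E →L[ℝ] E)‖ + 1 with hC
  have hC0 : 0 < C := by positivity
  filter_upwards [hX _ hK' (δ / C) (by positivity), self_mem_nhdsWithin] with h ⟨g, hg, h1⟩ hpos
  have hpos : 0 < h := hpos
  refine ⟨T ∘ g ∘ T.symm, hG.comp_mem hT (hG.comp_mem hg hT'), fun p hp => ?_⟩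
  have h2 := h1 (T.symm p) ⟨p, hp, rfl⟩
  calc ‖(T ∘ g ∘ T.symm) p - (p + h • T (X (T.symm p)))‖
      = ‖(T : E →L[ℝ] E) (g (T.symm p) - (T.symm p + h • X (T.symm p)))‖ := by simp
    _ ≤ C * (δ / C * h) := by
        refine (ContinuousLinearMap.le_opNorm _ _).trans ?_
        gcongr
        rw [hC]; linarith
    _ = δ * h := by field_simp

/-- The continuous vector fields `X` such that both `X` and `-X` are infinitesimally generated. -/
def genFields [ProperSpace E] (G : Set (E → E)) (hG : IsMapMonoid G) : Submodule ℝ (E → E) where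
  carrier := {X | Continuous X ∧ InfGen G X ∧ InfGen G (-X)}
  zero_mem' := ⟨continuous_const, InfGen.zero hG, by rw [neg_zero]; exact InfGen.zero hG⟩
  add_mem' := by
    rintro X Y ⟨hX, hX1, hX2⟩ ⟨hY, hY1, hY2⟩
    refine ⟨hX.add hY, hX1.add hG hX hY hY1, ?_⟩
    rw [neg_add]
    exact hX2.add hG hX.neg hY.neg hY2
  smul_mem' := by
    rintro c X ⟨hX, hX1, hX2⟩
    refine ⟨hX.const_smul c, ?_⟩
    rcases le_total 0 c with hc | hc
    · exact ⟨hX1.smul hG hc, by rw [← smul_neg]; exact hX2.smul hG hc⟩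
    · refine ⟨?_, ?_⟩
      · have := hX2.smul hG (neg_nonneg.2 hc)
        rwa [smul_neg, neg_smul, neg_neg] at this
      · have := hX1.smul hG (neg_nonneg.2 hc)
        rwa [neg_smul] at this

variable [ProperSpace E] {G : Set (E → E)} {hG : IsMapMonoid G}

theorem genFields_of_approx {X : E → E} (hX : Continuous X)
    (h : ∀ K : Set E, IsCompact K → ∀ ε > 0, ∃ Y ∈ genFields G hG, ∀ p ∈ K, ‖X p - Y p‖ ≤ ε) :
    X ∈ genFields G hG := by
  refine ⟨hX, InfGen.of_approx fun K hK ε hε => ?_, InfGen.of_approx fun K hK ε hε => ?_⟩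
  · obtain ⟨Y, hY, h1⟩ := h K hK ε hε
    exact ⟨Y, hY.2.1, h1⟩
  · obtain ⟨Y, hY, h1⟩ := h K hK ε hε
    refine ⟨-Y, hY.2.2, fun p hp => ?_⟩
    rw [Pi.neg_apply, Pi.neg_apply, ← neg_sub', norm_neg]
    exact h1 p hp

/-- Joint continuity makes `Y r → Y 0` uniform on compact sets. This reaches degenerate fields that
rescaled linear conjugations only approach. -/
theorem genFields_of_limit {Y : ℝ → E → E} (hc : Continuous fun q : ℝ × E => Y q.1 q.2)
    (h : ∀ r ≠ 0, Y r ∈ genFields G hG) : Y 0 ∈ genFields G hG := by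
  refine genFields_of_approx (hc.comp (by fun_prop : Continuous fun p : E => ((0 : ℝ), p))) ?_
  intro K hK ε hε
  have h1 : ∀ᶠ r in 𝓝 (0 : ℝ), ∀ x ∈ K, dist (Y 0 x) (Y r x) < ε := by
    refine hK.eventually_forall_of_forall_eventually fun x _ => ?_
    have h3 : Continuous fun z : ℝ × E => dist (Y 0 z.2) (Y z.1 z.2) := by
      refine Continuous.dist ?_ ?_
      · exact hc.comp (by fun_prop : Continuous fun z : ℝ × E => ((0 : ℝ), z.2))
      · exact hc
    exact h3.continuousAt.eventually_lt_const (by simpa using hε)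
  have h2 : ∀ᶠ r in 𝓝[≠] (0 : ℝ), ∀ x ∈ K, dist (Y 0 x) (Y r x) < ε :=
    nhdsWithin_le_nhds h1
  obtain ⟨r, hr1, hr2⟩ := (h2.and self_mem_nhdsWithin).exists
  exact ⟨Y r, h r hr2, fun p hp => by rw [← dist_eq_norm]; exact (hr1 p hp).le⟩

theorem genFields_conj {X : E → E} (hX : X ∈ genFields G hG) (T : E ≃L[ℝ] E) (hT : ⇑T ∈ G)
    (hT' : ⇑T.symm ∈ G) : (fun p => T (X (T.symm p))) ∈ genFields G hG := by
  refine ⟨T.continuous.comp (hX.1.comp T.symm.continuous), hX.2.1.conj hG T hT hT', ?_⟩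
  have := hX.2.2.conj hG T hT hT'
  convert this using 1
  ext p
  simp

end Infinitesimal

/-! ### Euler's method along the flow. -/

section Flow

open Filter Topology

theorem IsMapMonoid.iterate_mem {E : Type*} {G : Set (E → E)} (hG : IsMapMonoid G) {g : E → E} (hg : g ∈ G)
    (n : ℕ) : g^[n] ∈ G := by
  induction n with
  | zero => exact hG.id_mem
  | succ n ih => exact hG.comp_mem ih hg

variable {E : Type*} [NormedAddCommGroup E] [NormedSpace ℝ E]

/-- Trajectories starting near a trajectory defined on `[0, 1]` remain at distance at most `1`. -/
theorem exists_nhds_dist_trajectory_le {X : E → E}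
    (hX : ∀ R : ℝ, ∃ C : NNReal, LipschitzOnWith C X (Metric.closedBall 0 R))
    {γ : E → ℝ → E} (h0 : ∀ p, γ p 0 = p)
    (hγ : ∀ p, ∀ t ∈ Set.Icc (0 : ℝ) 1, HasDerivAt (γ p) (X (γ p t)) t) (p₀ : E) :
    ∃ U ∈ 𝓝 p₀, ∀ p ∈ U, ∀ t ∈ Set.Icc (0 : ℝ) 1, dist (γ p t) (γ p₀ t) ≤ 1 := by
  have hcont : ∀ p, ContinuousOn (γ p) (Set.Icc 0 1) := fun p t ht =>
    (hγ p t ht).continuousAt.continuousWithinAt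
  obtain ⟨R, hR⟩ := (isCompact_Icc (a := (0 : ℝ)) (b := 1)).exists_bound_of_continuousOn
    (hcont p₀)
  obtain ⟨C, hC⟩ := hX (R + 1)
  -- With this radius, Grönwall on `[0, 1]` bounds the distance by `1 / 2`.
  refine ⟨Metric.ball p₀ (Real.exp (-C) / 2), Metric.ball_mem_nhds _ (by positivity), ?_⟩
  intro p hp
  by_contra! hcon
  obtain ⟨t₁, ht₁, hd₁⟩ := hcon
  set S : Set ℝ := {t | t ∈ Set.Icc (0 : ℝ) 1 ∧ 1 ≤ dist (γ p t) (γ p₀ t)} with hS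
  have hcd : ContinuousOn (fun t => dist (γ p t) (γ p₀ t)) (Set.Icc 0 1) :=
    continuous_dist.comp_continuousOn ((hcont p).prodMk (hcont p₀))
  have hSc : IsCompact S := by
    have : S = Set.Icc 0 1 ∩ (fun t => dist (γ p t) (γ p₀ t)) ⁻¹' Set.Ici 1 := rfl
    rw [this]
    exact isCompact_Icc.of_isClosed_subset
      (hcd.preimage_isClosed_of_isClosed isClosed_Icc isClosed_Ici) Set.inter_subset_left
  -- Before the first time `τ` at distance `1`, both trajectories stay in the ball where `C` is
  -- valid, so Grönwall applies up to `τ` and contradicts the choice of `τ`.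
  obtain ⟨τ, ⟨hτ, hdτ⟩, hmin⟩ := hSc.exists_isLeast ⟨t₁, ht₁, hd₁.le⟩
  have hlt : ∀ t ∈ Set.Ico 0 τ, dist (γ p t) (γ p₀ t) < 1 := by
    intro t ht
    by_contra! h
    exact absurd (hmin ⟨⟨ht.1, ht.2.le.trans hτ.2⟩, h⟩) (not_le.2 ht.2)
  have hsub : Set.Icc 0 τ ⊆ Set.Icc (0 : ℝ) 1 := Set.Icc_subset_Icc_right hτ.2
  have hsub' : Set.Ico 0 τ ⊆ Set.Icc (0 : ℝ) 1 := Set.Ico_subset_Icc_self.trans hsub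
  have hp₀ : ∀ t ∈ Set.Ico 0 τ, γ p₀ t ∈ Metric.closedBall (0 : E) (R + 1) := by
    intro t ht
    rw [mem_closedBall_zero_iff]
    linarith [hR t (hsub' ht)]
  have hp' : ∀ t ∈ Set.Ico 0 τ, γ p t ∈ Metric.closedBall (0 : E) (R + 1) := by
    intro t ht
    rw [mem_closedBall_zero_iff]
    have h1 := hR t (hsub' ht)
    have h2 := hlt t ht
    rw [dist_eq_norm] at h2
    calc ‖γ p t‖ = ‖(γ p t - γ p₀ t) + γ p₀ t‖ := by simp
      _ ≤ 1 + R := (norm_add_le _ _).trans (add_le_add h2.le h1)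
      _ = R + 1 := add_comm _ _
  have hg := dist_le_of_trajectories_ODE_of_mem (v := fun _ => X)
    (s := fun _ => Metric.closedBall (0 : E) (R + 1)) (K := C) (f := γ p) (g := γ p₀)
    (a := 0) (b := τ) (δ := dist p p₀) (fun t _ => hC) ((hcont p).mono hsub)
    (fun t ht => (hγ p t (hsub' ht)).hasDerivWithinAt) hp' ((hcont p₀).mono hsub)
    (fun t ht => (hγ p₀ t (hsub' ht)).hasDerivWithinAt) hp₀ (by rw [h0, h0]) τ ⟨hτ.1, le_rfl⟩
  have h1 : dist p p₀ < Real.exp (-C) / 2 := hp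
  have h2 : Real.exp (C * (τ - 0)) ≤ Real.exp C := by
    apply Real.exp_le_exp.2
    have : (0 : ℝ) ≤ C := C.2
    nlinarith [hτ.2]
  have h3 : dist p p₀ * Real.exp (C * (τ - 0)) ≤ Real.exp (-C) / 2 * Real.exp C := by
    gcongr
  have h4 : Real.exp (-C) / 2 * Real.exp C = 1 / 2 := by
    rw [div_mul_eq_mul_div, ← Real.exp_add]; simp
  linarith

theorem exists_bound_trajectories {X : E → E}
    (hX : ∀ R : ℝ, ∃ C : NNReal, LipschitzOnWith C X (Metric.closedBall 0 R))
    {γ : E → ℝ → E} (h0 : ∀ p, γ p 0 = p)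
    (hγ : ∀ p, ∀ t ∈ Set.Icc (0 : ℝ) 1, HasDerivAt (γ p) (X (γ p t)) t)
    {K : Set E} (hK : IsCompact K) :
    ∃ R, 0 ≤ R ∧ ∀ p ∈ K, ∀ t ∈ Set.Icc (0 : ℝ) 1, ‖γ p t‖ ≤ R := by
  refine hK.induction_on (p := fun K => ∃ R, 0 ≤ R ∧ ∀ p ∈ K, ∀ t ∈ Set.Icc (0 : ℝ) 1, ‖γ p t‖ ≤ R)
    ⟨0, le_rfl, by simp⟩ ?_ ?_ ?_
  · rintro s t hst ⟨R, hR, h⟩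
    exact ⟨R, hR, fun p hp => h p (hst hp)⟩
  · rintro s t ⟨R, hR, h⟩ ⟨R', hR', h'⟩
    refine ⟨max R R', le_max_of_le_left hR, ?_⟩
    rintro p (hp | hp) u hu
    · exact (h p hp u hu).trans (le_max_left _ _)
    · exact (h' p hp u hu).trans (le_max_right _ _)
  · intro p₀ _
    obtain ⟨U, hU, h⟩ := exists_nhds_dist_trajectory_le hX h0 hγ p₀
    obtain ⟨R, hR⟩ := (isCompact_Icc (a := (0 : ℝ)) (b := 1)).exists_bound_of_continuousOn
      (f := γ p₀) (fun t ht => (hγ p₀ t ht).continuousAt.continuousWithinAt)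
    have hR0 : 0 ≤ R := (norm_nonneg _).trans (hR 0 ⟨le_rfl, zero_le_one⟩)
    refine ⟨U, mem_nhdsWithin_of_mem_nhds hU, R + 1, by positivity, fun p hp t ht => ?_⟩
    have h1 := h p hp t ht
    rw [dist_eq_norm] at h1
    calc ‖γ p t‖ = ‖(γ p t - γ p₀ t) + γ p₀ t‖ := by simp
      _ ≤ 1 + R := (norm_add_le _ _).trans (add_le_add h1 (hR t ht))
      _ = R + 1 := add_comm _ _

/-- The error of one explicit Euler step. -/
theorem norm_euler_step_le {X : E → E} {R : ℝ} {C : NNReal} {M : ℝ}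
    (hC : LipschitzOnWith C X (Metric.closedBall 0 R))
    (hM : ∀ p ∈ Metric.closedBall (0 : E) R, ‖X p‖ ≤ M) {γ : ℝ → E}
    (hγ : ∀ t ∈ Set.Icc (0 : ℝ) 1, HasDerivAt γ (X (γ t)) t)
    (hR : ∀ t ∈ Set.Icc (0 : ℝ) 1, ‖γ t‖ ≤ R) {t h : ℝ} (ht : 0 ≤ t) (hh : 0 ≤ h)
    (hth : t + h ≤ 1) : ‖γ t + h • X (γ t) - γ (t + h)‖ ≤ C * M * h * h := by
  have hmem : ∀ s ∈ Set.Icc t (t + h), s ∈ Set.Icc (0 : ℝ) 1 := fun s hs =>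
    ⟨ht.trans hs.1, hs.2.trans hth⟩
  have hM0 : 0 ≤ M := (norm_nonneg _).trans
    (hM (γ t) (mem_closedBall_zero_iff.2 (hR t (hmem t ⟨le_rfl, by linarith⟩))))
  have h1 : ∀ s ∈ Set.Icc t (t + h), ‖γ s - γ t‖ ≤ M * h := by
    intro s hs
    refine (norm_image_sub_le_of_norm_deriv_le_segment' (f := γ) (f' := fun s => X (γ s))
      (a := t) (b := t + h) (C := M)
      (fun x hx => (hγ x (hmem x hx)).hasDerivWithinAt)
      (fun x hx => hM _ (mem_closedBall_zero_iff.2 (hR x (hmem x ⟨hx.1, hx.2.le⟩)))) s hs).trans ?_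
    have : s - t ≤ h := by linarith [hs.2]
    gcongr
  -- Subtracting the linear motion leaves the derivative `X(γ s) - X(γ t)`, which the Lipschitz
  -- bound makes at most `C M h`.
  have h2 := norm_image_sub_le_of_norm_deriv_le_segment'
    (f := fun s => γ s - s • X (γ t)) (f' := fun s => X (γ s) - (1 : ℝ) • X (γ t))
    (a := t) (b := t + h) (C := C * (M * h))
    (fun x hx => ((hγ x (hmem x hx)).sub ((hasDerivAt_id x).smul_const (X (γ t)))).hasDerivWithinAt)
    (fun x hx => by
      rw [one_smul]
      refine (hC.norm_sub_le (mem_closedBall_zero_iff.2 (hR x (hmem x ⟨hx.1, hx.2.le⟩)))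
        (mem_closedBall_zero_iff.2 (hR t (hmem t ⟨le_rfl, by linarith⟩)))).trans ?_
      gcongr
      exact h1 x ⟨hx.1, hx.2.le⟩) (t + h) ⟨by linarith, le_rfl⟩
  calc ‖γ t + h • X (γ t) - γ (t + h)‖
      = ‖γ (t + h) - (t + h) • X (γ t) - (γ t - t • X (γ t))‖ := by
        rw [← norm_neg]; congr 1; rw [add_smul]; abel
    _ ≤ C * (M * h) * (t + h - t) := h2
    _ = C * M * h * h := by ring

/-- The approximant is an iterate of one map with step `1 / (n + 1)`. Each step costs `η h` from
generation and `η h` from Euler's method, and a discrete Grönwall estimate sums these errors. -/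
theorem InfGen.approx_timeOne [ProperSpace E] {G : Set (E → E)} (hG : IsMapMonoid G) {X : E → E}
    (hgen : InfGen G X)
    (hX : ∀ R : ℝ, ∃ C : NNReal, LipschitzOnWith C X (Metric.closedBall 0 R))
    {γ : E → ℝ → E} (h0 : ∀ p, γ p 0 = p)
    (hγ : ∀ p, ∀ t ∈ Set.Icc (0 : ℝ) 1, HasDerivAt (γ p) (X (γ p t)) t)
    {K : Set E} (hK : IsCompact K) {ε : ℝ} (hε : 0 < ε) :
    ∃ g ∈ G, ∀ p ∈ K, ‖γ p 1 - g p‖ < ε := by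
  obtain ⟨R, hR0, hR⟩ := exists_bound_trajectories hX h0 hγ hK
  obtain ⟨C, hC⟩ := hX (R + 1)
  have hL : IsCompact (Metric.closedBall (0 : E) (R + 1)) := isCompact_closedBall _ _
  obtain ⟨M, hM⟩ := hL.exists_bound_of_continuousOn hC.continuousOn
  have hM0 : 0 ≤ M := (norm_nonneg _).trans (hM 0 (by simp; positivity))
  -- Chosen so that the final error `2 η e^C` is `min ε 1 / 2`. The minimum with `1` keeps the
  -- iterates in the ball of radius `R + 1`.
  set η := min ε 1 * Real.exp (-C) / 4 with hη
  have hη0 : 0 < η := by positivity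
  have hev : ∀ᶠ h : ℝ in 𝓝[>] 0, C * M * h ≤ η := by
    have : Tendsto (fun h : ℝ => C * M * h) (𝓝[>] 0) (𝓝 (C * M * 0)) := by
      apply Tendsto.mono_left _ nhdsWithin_le_nhds
      exact Continuous.tendsto (by fun_prop) _
    exact this.eventually_le_const (by simpa using hη0)
  have htend : Tendsto (fun n : ℕ => 1 / ((n : ℝ) + 1)) atTop (𝓝[>] 0) :=
    tendsto_nhdsWithin_iff.2 ⟨tendsto_one_div_add_atTop_nhds_zero_nat,
      Eventually.of_forall fun n => by show (0:ℝ) < _; positivity⟩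
  obtain ⟨n, ⟨g, hg, hgap⟩, hsm⟩ := (htend.eventually ((hgen _ hL η hη0).and hev)).exists
  set h : ℝ := 1 / ((n : ℝ) + 1) with hh
  have hpos : 0 < h := by positivity
  have hn : ((n : ℝ) + 1) * h = 1 := by rw [hh]; field_simp
  refine ⟨g^[n + 1], hG.iterate_mem hg _, fun p hp => ?_⟩
  have hexp : ∀ k : ℕ, k ≤ n + 1 → (1 + C * h) ^ k ≤ Real.exp C := by
    intro k hk
    calc (1 + C * h) ^ k ≤ (Real.exp (C * h)) ^ k := by
          gcongr
          linarith [Real.add_one_le_exp (C * h)]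
      _ = Real.exp (k * (C * h)) := by rw [← Real.exp_nat_mul]
      _ ≤ Real.exp C := by
          apply Real.exp_le_exp.2
          have : (k : ℝ) ≤ n + 1 := by exact_mod_cast hk
          have h3 : (k : ℝ) * h ≤ 1 := by rw [← hn]; gcongr
          have : (0 : ℝ) ≤ C := C.2
          nlinarith
  have hbound : ∀ k : ℕ, k ≤ n + 1 → (k : ℝ) * h * (2 * η) * (1 + C * h) ^ k ≤ min ε 1 / 2 := by
    intro k hk
    have h1 : (k : ℝ) * h ≤ 1 := by
      rw [← hn]; gcongr; exact_mod_cast hk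
    calc (k : ℝ) * h * (2 * η) * (1 + C * h) ^ k ≤ 1 * (2 * η) * Real.exp C := by
          gcongr
          exact hexp k hk
      _ = min ε 1 / 2 * (Real.exp (-C) * Real.exp C) := by rw [hη]; ring
      _ = min ε 1 / 2 := by rw [← Real.exp_add]; simp
  have hmin1 : min ε 1 / 2 < 1 := by have := min_le_right ε 1; linarith
  have key : ∀ k : ℕ, k ≤ n + 1 →
      ‖g^[k] p - γ p (k * h)‖ ≤ k * h * (2 * η) * (1 + C * h) ^ k := by
    intro k
    induction k with
    | zero => intro _; simp [h0]
    | succ k ih =>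
      intro hk
      have ih := ih (by omega)
      have hk1 : ((k + 1 : ℕ) : ℝ) * h ≤ 1 := by
        rw [← hn]; gcongr; exact_mod_cast hk
      push_cast at hk1
      have ht0 : 0 ≤ (k : ℝ) * h := by positivity
      have ht1 : (k : ℝ) * h + h ≤ 1 := by linarith
      have hγR := hR p hp (k * h) ⟨ht0, by linarith⟩
      set y := g^[k] p with hy
      set q := γ p (k * h) with hq
      have hyq : ‖y - q‖ ≤ 1 := (ih.trans (hbound k (by omega))).trans hmin1.le
      have hq' : q ∈ Metric.closedBall (0 : E) (R + 1) := by
        rw [mem_closedBall_zero_iff]; linarith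
      have hy' : y ∈ Metric.closedBall (0 : E) (R + 1) := by
        rw [mem_closedBall_zero_iff]
        calc ‖y‖ = ‖(y - q) + q‖ := by simp
          _ ≤ 1 + R := (norm_add_le _ _).trans (add_le_add hyq hγR)
          _ = R + 1 := add_comm _ _
      have e1 := hgap y hy'
      have e2 : ‖X y - X q‖ ≤ C * ‖y - q‖ := hC.norm_sub_le hy' hq'
      have e3 : ‖q + h • X q - γ p (k * h + h)‖ ≤ C * M * h * h :=
        norm_euler_step_le hC hM (hγ p) (fun t ht => (hR p hp t ht).trans (by linarith))
          ht0 hpos.le ht1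
      have e4 : ((k + 1 : ℕ) : ℝ) * h = k * h + h := by push_cast; ring
      rw [Function.iterate_succ_apply', ← hy, e4]
      calc ‖g y - γ p (k * h + h)‖
          = ‖(g y - (y + h • X y)) + ((y - q) + h • (X y - X q))
              + (q + h • X q - γ p (k * h + h))‖ := by
            congr 1; rw [smul_sub]; abel
        _ ≤ η * h + (‖y - q‖ + h * (C * ‖y - q‖)) + η * h := by
            refine norm_add₃_le.trans ?_
            refine add_le_add (add_le_add e1 ((norm_add_le _ _).trans ?_)) (e3.trans (by gcongr))
            rw [norm_smul, Real.norm_of_nonneg hpos.le]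
            gcongr
        _ = 2 * η * h * 1 + (1 + C * h) * ‖y - q‖ := by ring
        _ ≤ 2 * η * h * (1 + C * h) ^ (k + 1)
            + (1 + C * h) * (k * h * (2 * η) * (1 + C * h) ^ k) := by
            gcongr
            exact one_le_pow₀ (by have : (0 : ℝ) ≤ C * h := by positivity
                                  linarith)
        _ = (k * h + h) * (2 * η) * (1 + C * h) ^ (k + 1) := by ring
  have h1 := (key (n + 1) le_rfl).trans (hbound (n + 1) le_rfl)
  rw [show ((n + 1 : ℕ) : ℝ) * h = 1 by push_cast; exact hn] at h1
  rw [norm_sub_rev]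
  have := min_le_left ε 1
  have hmin0 : 0 < min ε 1 := by positivity
  linarith

end Flow

/-! ### Homogeneous polynomial fields and their divergence. -/

section HomogeneousPolynomials

open Filter Topology

/-- A functional that vanishes on `S` but not on `c k` would turn the sum into a polynomial in `t`
that is identically zero yet has a nonzero coefficient. Used for polarization. -/
theorem coeff_mem_of_forall_sum_mem {M : Type*} [AddCommGroup M] [Module ℝ M] (S : Submodule ℝ M)
    (n : ℕ) (c : ℕ → M) (h : ∀ t : ℝ, ∑ k ∈ Finset.range (n + 1), t ^ k • c k ∈ S) :
    ∀ k ≤ n, c k ∈ S := by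
  intro k hk
  by_contra hcon
  obtain ⟨f, hf, hS⟩ := S.exists_le_ker_of_notMem hcon
  set P : Polynomial ℝ := ∑ k ∈ Finset.range (n + 1), Polynomial.C (f (c k)) * Polynomial.X ^ k
    with hP
  have hP0 : P = 0 := by
    refine Polynomial.funext fun t => ?_
    have h1 : f (∑ k ∈ Finset.range (n + 1), t ^ k • c k) = 0 := hS (h t)
    simp only [map_sum, map_smul, smul_eq_mul] at h1
    simp only [hP, Polynomial.eval_finsetSum, Polynomial.eval_mul, Polynomial.eval_C,
      Polynomial.eval_pow, Polynomial.eval_X, Polynomial.eval_zero]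
    rw [← h1]
    exact Finset.sum_congr rfl fun _ _ => mul_comm _ _
  have h2 : P.coeff k = f (c k) := by
    simp only [hP, Polynomial.finsetSum_coeff, Polynomial.coeff_C_mul, Polynomial.coeff_X_pow]
    rw [Finset.sum_eq_single k] <;> simp +contextual [eq_comm]
    omega
  rw [hP0, Polynomial.coeff_zero] at h2
  exact hf h2.symm

variable {E W W' : Type*} [NormedAddCommGroup E] [NormedSpace ℝ E]
  [NormedAddCommGroup W] [NormedSpace ℝ W] [NormedAddCommGroup W'] [NormedSpace ℝ W']

/-- Homogeneous polynomial maps of degree `d`, as the span of the maps `x ↦ ℓ(x)^d e`. -/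
def HPoly (E W : Type*) [NormedAddCommGroup E] [NormedSpace ℝ E] [NormedAddCommGroup W]
    [NormedSpace ℝ W] (d : ℕ) : Submodule ℝ (E → W) :=
  Submodule.span ℝ {f | ∃ (l : E →L[ℝ] ℝ) (e : W), f = fun x => l x ^ d • e}

namespace HPoly

theorem pow_smul_mem (d : ℕ) (l : E →L[ℝ] ℝ) (e : W) : (fun x => l x ^ d • e) ∈ HPoly E W d :=
  Submodule.subset_span ⟨l, e, rfl⟩

/-- Polarization: `l l'^m` is, up to the factor `m + 1`, the coefficient of `t` in `(t l + l')^(m +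
1)`. -/
theorem mul_mem {m : ℕ} (l : E →L[ℝ] ℝ) {f : E → W} (hf : f ∈ HPoly E W m) :
    (fun x => l x • f x) ∈ HPoly E W (m + 1) := by
  induction hf using Submodule.span_induction with
  | mem f hf =>
    obtain ⟨l', e, rfl⟩ := hf
    have h := coeff_mem_of_forall_sum_mem (HPoly E W (m + 1)) (m + 1)
      (fun k x => ((l x ^ k * l' x ^ (m + 1 - k)) * ((m + 1).choose k : ℝ)) • e) (fun t => by
        have := pow_smul_mem (m + 1) (t • l + l') e
        convert this using 1
        ext x
        simp only [Finset.sum_apply, Pi.smul_apply, add_apply,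
          smul_apply, smul_eq_mul, add_pow, Finset.sum_smul, mul_pow, smul_smul]
        refine Finset.sum_congr rfl fun k _ => ?_
        congr 1; ring) 1 (by omega)
    have h2 := (HPoly E W (m + 1)).smul_mem ((m + 1 : ℝ)⁻¹) h
    convert h2 using 1
    ext x
    simp only [Pi.smul_apply, smul_smul]
    congr 1
    have : (m + 1 : ℝ) ≠ 0 := by positivity
    field_simp
    simp
  | zero =>
    convert (HPoly E W (m + 1)).zero_mem using 1
    ext x; simp
  | add f g _ _ hf hg =>
    convert (HPoly E W (m + 1)).add_mem hf hg using 1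
    ext x; simp
  | smul c f _ hf =>
    convert (HPoly E W (m + 1)).smul_mem c hf using 1
    ext x; simp [smul_comm c]

theorem clm_comp_mem {m : ℕ} (L : W →L[ℝ] W') {f : E → W} (hf : f ∈ HPoly E W m) :
    (fun x => L (f x)) ∈ HPoly E W' m := by
  induction hf using Submodule.span_induction with
  | mem f hf =>
    obtain ⟨l', e, rfl⟩ := hf
    simpa using pow_smul_mem m l' (L e)
  | zero =>
    convert (HPoly E W' m).zero_mem using 1
    ext x; simp
  | add f g _ _ hf hg =>
    convert (HPoly E W' m).add_mem hf hg using 1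
    ext x; simp
  | smul c f _ hf =>
    convert (HPoly E W' m).smul_mem c hf using 1
    ext x; simp

theorem contDiff {m : ℕ} {f : E → W} (hf : f ∈ HPoly E W m) : ContDiff ℝ ⊤ f := by
  induction hf using Submodule.span_induction with
  | mem f hf =>
    obtain ⟨l', e, rfl⟩ := hf
    exact (l'.contDiff.pow m).smul contDiff_const
  | zero => exact contDiff_const
  | add f g _ _ hf hg => exact hf.add hg
  | smul c f _ hf => exact hf.const_smul c

theorem differentiable {m : ℕ} {f : E → W} (hf : f ∈ HPoly E W m) : Differentiable ℝ f :=
  (contDiff hf).differentiable (by simp)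

theorem continuous {m : ℕ} {f : E → W} (hf : f ∈ HPoly E W m) : Continuous f :=
  (contDiff hf).continuous

theorem apply_smul {m : ℕ} {f : E → W} (hf : f ∈ HPoly E W m) (t : ℝ) (x : E) :
    f (t • x) = t ^ m • f x := by
  induction hf using Submodule.span_induction with
  | mem f hf =>
    obtain ⟨l', e, rfl⟩ := hf
    simp [mul_pow, smul_smul]
  | zero => simp
  | add f g _ _ hf hg => simp [hf, hg]
  | smul c f _ hf => simp [hf, smul_comm c]

theorem hasFDerivAt_pow_smul (d : ℕ) (l : E →L[ℝ] ℝ) (e : W) (x : E) :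
    HasFDerivAt (fun x => l x ^ d • e) ((((d : ℝ) * l x ^ (d - 1)) • l).smulRight e) x := by
  have h := (l.hasFDerivAt (x := x)).pow d
  have h2 := h.smul_const e
  convert h2 using 1
  ext v
  simp

theorem fderiv_pow_smul (d : ℕ) (l : E →L[ℝ] ℝ) (e : W) (x v : E) :
    fderiv ℝ (fun x => l x ^ d • e) x v = (d * l x ^ (d - 1) * l v) • e := by
  rw [(hasFDerivAt_pow_smul d l e x).fderiv]
  simp

theorem fderiv_mem {m : ℕ} {f : E → W} (hf : f ∈ HPoly E W m) (v : E) :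
    (fun x => fderiv ℝ f x v) ∈ HPoly E W (m - 1) := by
  induction hf using Submodule.span_induction with
  | mem f hf =>
    obtain ⟨l', e, rfl⟩ := hf
    have := pow_smul_mem (m - 1) l' ((m * l' v : ℝ) • e)
    convert this using 1
    ext x
    rw [fderiv_pow_smul, smul_smul]
    congr 1; ring
  | zero =>
    convert (HPoly E W (m - 1)).zero_mem using 1
    ext x; simp
  | add f g hf' hg' hf hg =>
    convert (HPoly E W (m - 1)).add_mem hf hg using 1
    ext x
    rw [fderiv_add (differentiable hf' x) (differentiable hg' x)]
    rfl
  | smul c f hf' hf =>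
    convert (HPoly E W (m - 1)).smul_mem c hf using 1
    ext x
    rw [fderiv_const_smul (differentiable hf' x)]
    rfl

/-- Euler's identity for homogeneous functions. -/
theorem fderiv_self {m : ℕ} {f : E → W} (hf : f ∈ HPoly E W m) (x : E) :
    fderiv ℝ f x x = (m : ℝ) • f x := by
  induction hf using Submodule.span_induction with
  | mem f hf =>
    obtain ⟨l', e, rfl⟩ := hf
    rw [fderiv_pow_smul, smul_smul]
    rcases m with _ | m
    · simp
    · congr 1
      simp
      ring
  | zero => simp
  | add f g hf' hg' hf hg =>
    rw [fderiv_add (differentiable hf' x) (differentiable hg' x)]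
    simp [hf, hg]
  | smul c f hf' hf =>
    rw [fderiv_const_smul (differentiable hf' x)]
    simp [hf, smul_comm c]

end HPoly

/-- The span of the shear fields `x ↦ ℓ(x)^d e` with `ℓ(e) = 0`. -/
def linearShearFields (E : Type*) [NormedAddCommGroup E] [NormedSpace ℝ E] (d : ℕ) :
    Submodule ℝ (E → E) :=
  Submodule.span ℝ {X | ∃ (l : E →L[ℝ] ℝ) (e : E), l e = 0 ∧ X = fun x => l x ^ d • e}

/-- For `H = c ℓ^(d+1)` the direction is a multiple of `ℓ(u) v - ℓ(v) u`, which `ℓ` annihilates. -/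
theorem hamiltonian_mem_linearShearFields {d : ℕ} {H : E → ℝ} (hH : H ∈ HPoly E ℝ (d + 1))
    (u v : E) : (fun p => fderiv ℝ H p u • v - fderiv ℝ H p v • u) ∈ linearShearFields E d := by
  induction hH using Submodule.span_induction with
  | mem f hf =>
    obtain ⟨l, c, rfl⟩ := hf
    refine Submodule.subset_span ⟨l, ((d + 1 : ℝ) * c) • (l u • v - l v • u), ?_, ?_⟩
    · simp; ring_nf; simp
    · ext p
      rw [HPoly.fderiv_pow_smul, HPoly.fderiv_pow_smul, smul_smul, smul_sub, smul_smul, smul_smul]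
      congr 2 <;> (simp only [smul_eq_mul, Nat.add_sub_cancel]; push_cast; ring)
  | zero =>
    convert (linearShearFields E d).zero_mem using 1
    ext x; simp
  | add f g hf' hg' hf hg =>
    convert (linearShearFields E d).add_mem hf hg using 1
    ext p
    rw [fderiv_add (HPoly.differentiable hf' p) (HPoly.differentiable hg' p)]
    simp only [add_apply, Pi.add_apply, add_smul]
    abel
  | smul c f hf' hf =>
    convert (linearShearFields E d).smul_mem c hf using 1
    ext p
    rw [fderiv_const_smul (HPoly.differentiable hf' p)]
    simp only [smul_apply, Pi.smul_apply, smul_sub, smul_smul, smul_eq_mul]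

/-- The divergence of a vector field on a real vector space. -/
noncomputable def realDiv (X : E → E) (p : E) : ℝ :=
  LinearMap.trace ℝ E (fderiv ℝ X p : E →ₗ[ℝ] E)

theorem trace_eq_sum_coord {ι V : Type*} [Fintype ι] [AddCommGroup V] [Module ℝ V]
    (b : Module.Basis ι ℝ V) (L : V →ₗ[ℝ] V) : LinearMap.trace ℝ V L = ∑ i, b.coord i (L (b i)) := by
  classical
  rw [LinearMap.trace_eq_matrix_trace ℝ b, Matrix.trace]
  simp [LinearMap.toMatrix_apply]

/-- When `div X = 0`, Euler's identity gives `(N + d - 1) X = ∑ᵢⱼ (∂ᵢ(xᵢ Xⱼ) bⱼ - ∂ⱼ(xᵢ Xⱼ) bᵢ)`: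
the first terms add up to `(N + d) X`, the second to `X`. Each summand is a Hamiltonian field in the
plane of `bᵢ, bⱼ`. -/
theorem mem_linearShearFields_of_realDiv_eq_zero [FiniteDimensional ℝ E] [Nontrivial E] {d : ℕ}
    {X : E → E} (hX : X ∈ HPoly E E d) (hdiv : ∀ p, realDiv X p = 0) :
    X ∈ linearShearFields E d := by
  rcases Nat.eq_zero_or_pos d with rfl | hd
  · refine (Submodule.span_le.2 ?_ : HPoly E E 0 ≤ linearShearFields E 0) hX
    rintro _ ⟨l, e, rfl⟩
    -- A constant field is a shear field for `ℓ = 0`, since `0 ^ 0 = 1`. The general formula would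
    -- divide by `N - 1` here.
    exact Submodule.subset_span ⟨0, e, by simp, by simp⟩
  set b := Module.finBasis ℝ E with hb
  set N := Module.finrank ℝ E with hN
  have hN0 : 0 < N := Module.finrank_pos
  let x : Fin N → E →L[ℝ] ℝ := fun i => LinearMap.toContinuousLinearMap (b.coord i)
  have hx : ∀ i p, x i p = b.coord i p := fun i p => rfl
  have hsum : ∀ p, ∑ i, x i p • b i = p := fun p => b.sum_repr p
  have hxb : ∀ i j, x i (b j) = if j = i then 1 else 0 := fun i j => by
    rw [hx, Module.Basis.coord_apply, Module.Basis.repr_self, Finsupp.single_apply]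
  have hH : ∀ i j, (fun p => x i p • x j (X p)) ∈ HPoly E ℝ (d + 1) := fun i j =>
    HPoly.mul_mem (x i) (HPoly.clm_comp_mem (x j) hX)
  have hfd : ∀ i j p v, fderiv ℝ (fun p => x i p • x j (X p)) p v =
      x i v * x j (X p) + x i p * x j (fderiv ℝ X p v) := by
    intro i j p v
    have h1 : HasFDerivAt (fun p => x j (X p)) ((x j).comp (fderiv ℝ X p)) p :=
      (x j).hasFDerivAt.comp p (HPoly.differentiable hX p).hasFDerivAt
    have h2 := (x i).hasFDerivAt (x := p) |>.mul h1
    have h3 : fderiv ℝ (fun p => x i p • x j (X p)) p = _ := h2.fderiv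
    rw [h3]
    simp
    ring
  have hmem : (∑ i, ∑ j, fun p => fderiv ℝ (fun p => x i p • x j (X p)) p (b i) • b j
      - fderiv ℝ (fun p => x i p • x j (X p)) p (b j) • b i) ∈ linearShearFields E d :=
    Submodule.sum_mem _ fun i _ => Submodule.sum_mem _ fun j _ =>
      hamiltonian_mem_linearShearFields (hH i j) (b i) (b j)
  have hc : (N + d - 1 : ℝ) ≠ 0 := by
    have h1 : (1 : ℝ) ≤ N := by exact_mod_cast hN0
    have h2 : (1 : ℝ) ≤ d := by exact_mod_cast hd
    linarith
  have := (linearShearFields E d).smul_mem (N + d - 1 : ℝ)⁻¹ hmem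
  convert this using 1
  ext p
  rw [Pi.smul_apply, eq_inv_smul_iff₀ hc]
  simp only [Finset.sum_apply, hfd]
  have htr : ∑ j, x j (fderiv ℝ X p (b j)) = 0 := by
    have := hdiv p
    rw [realDiv, trace_eq_sum_coord b] at this
    exact this
  have hE : ∑ i, x i p • fderiv ℝ X p (b i) = (d : ℝ) • X p := by
    rw [← HPoly.fderiv_self hX p]
    simpa only [map_sum, map_smul] using congrArg (fderiv ℝ X p) (hsum p)
  have e1 : ∀ i, ∑ j, (x i (b i) * x j (X p) + x i p * x j (fderiv ℝ X p (b i))) • b j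
      = X p + x i p • fderiv ℝ X p (b i) := by
    intro i
    simp only [add_smul, mul_smul, Finset.sum_add_distrib, ← Finset.smul_sum, hsum]
    simp [hxb]
  have e2 : ∀ i, ∑ j, (x i (b j) * x j (X p) + x i p * x j (fderiv ℝ X p (b j))) • b i
      = x i (X p) • b i := by
    intro i
    rw [← Finset.sum_smul, Finset.sum_add_distrib, ← Finset.mul_sum, htr]
    simp [hxb]
  simp only [Finset.sum_sub_distrib, e1, e2, hsum, Finset.sum_add_distrib, hE]
  rw [Finset.sum_const, Finset.card_univ, Fintype.card_fin, ← Nat.cast_smul_eq_nsmul ℝ, sub_smul,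
    add_smul, one_smul]

end HomogeneousPolynomials

/-! ### Quaternionic monomials as real polynomial maps. -/

section QuaternionPolynomials

theorem quaternion_mul_mem {E : Type*} [NormedAddCommGroup E] [NormedSpace ℝ E] {m : ℕ}
    (L : E →L[ℝ] ℍ[ℝ]) {f : E → ℍ[ℝ]} (hf : f ∈ HPoly E ℍ[ℝ] m) :
    (fun x => L x * f x) ∈ HPoly E ℍ[ℝ] (m + 1) := by
  let b := Module.finBasis ℝ ℍ[ℝ]
  have h : (fun x => L x * f x) = ∑ i, fun x =>
      ((LinearMap.toContinuousLinearMap (b.coord i)).comp L) x •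
        (ContinuousLinearMap.mul ℝ ℍ[ℝ] (b i)) (f x) := by
    ext1 x
    conv_lhs => rw [← b.sum_repr (L x)]
    rw [Finset.sum_apply, Finset.sum_mul]
    refine Finset.sum_congr rfl fun i _ => ?_
    simp
  rw [h]
  exact Submodule.sum_mem _ fun i _ => HPoly.mul_mem _ (HPoly.clm_comp_mem _ hf)

theorem quatMonomial_mem (a : ℍ[ℝ]) (l : List (Bool × ℍ[ℝ])) :
    quatMonomial a l ∈ HPoly QuatPlane ℍ[ℝ] l.length := by
  have h : (fun p : QuatPlane => (l.map fun s => (if s.1 then p.1 else p.2) * s.2).prod) ∈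
      HPoly QuatPlane ℍ[ℝ] l.length := by
    induction l with
    | nil => simpa using HPoly.pow_smul_mem 0 (0 : QuatPlane →L[ℝ] ℝ) (1 : ℍ[ℝ])
    | cons s l ih =>
      have h1 := HPoly.clm_comp_mem (ContinuousLinearMap.mul ℝ ℍ[ℝ] s.2) ih
      have h2 := quaternion_mul_mem (if s.1 then ContinuousLinearMap.fst ℝ ℍ[ℝ] ℍ[ℝ]
        else ContinuousLinearMap.snd ℝ ℍ[ℝ] ℍ[ℝ]) h1
      refine (congrArg (· ∈ HPoly QuatPlane ℍ[ℝ] (l.length + 1)) ?_).mp h2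
      funext p
      rcases s with ⟨_ | _, c⟩ <;> simp [mul_assoc]
  exact HPoly.clm_comp_mem (ContinuousLinearMap.mul ℝ ℍ[ℝ] a) h

theorem homogeneousPoly_le (d : ℕ) : homogeneousPoly d ≤ HPoly QuatPlane ℍ[ℝ] d := by
  refine Submodule.span_le.2 ?_
  rintro _ ⟨a, l, rfl, rfl⟩
  exact quatMonomial_mem a l

end QuaternionPolynomials

/-! ### Interpolation bounds for polynomials. -/

section PolynomialBounds

open Filter Topology

/-- The `k`-th smallest of distinct positive integers is at least `k`. -/
theorem factorial_card_le_prod (S : Finset ℕ) (hS : ∀ x ∈ S, 0 < x) :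
    S.card.factorial ≤ ∏ x ∈ S, x := by
  induction S using Finset.induction_on_max with
  | empty => simp
  | insert a s hlt ih =>
    have ha : a ∉ s := fun h => lt_irrefl _ (hlt a h)
    rw [Finset.card_insert_of_notMem ha, Finset.prod_insert ha, Nat.factorial_succ]
    refine Nat.mul_le_mul ?_ (ih fun x hx => hS x (Finset.mem_insert_of_mem hx))
    have hsub : s ⊆ Finset.Ioo 0 a := fun x hx =>
      Finset.mem_Ioo.2 ⟨hS x (Finset.mem_insert_of_mem hx), hlt x hx⟩
    have h1 := Finset.card_le_card hsub
    have h2 := hS a (Finset.mem_insert_self _ _)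
    rw [Nat.card_Ioo] at h1
    omega

/-- On each side of `i` the distances are distinct positive integers, so the product is at least `a!
b!`, and `(a + b)! ≤ 2^(a + b) a! b!`. It bounds Lagrange denominators from below. -/
theorem factorial_le_two_pow_mul_prod_dist (T : Finset ℕ) {i : ℕ} (hi : i ∈ T) :
    ((T.card - 1).factorial : ℝ) ≤ 2 ^ (T.card - 1) * ∏ j ∈ T.erase i, |(i : ℝ) - j| := by
  set A := T.filter (· < i) with hA
  set B := T.filter (i < ·) with hB
  have hdisj : Disjoint A B := by
    rw [Finset.disjoint_left]
    intro x hx hx'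
    simp only [hA, hB, Finset.mem_filter] at hx hx'
    omega
  have hun : T.erase i = A ∪ B := by
    ext x
    simp only [hA, hB, Finset.mem_erase, Finset.mem_union, Finset.mem_filter]
    constructor
    · rintro ⟨h1, h2⟩
      rcases lt_or_gt_of_ne h1 with h | h
      · exact Or.inl ⟨h2, h⟩
      · exact Or.inr ⟨h2, h⟩
    · rintro (⟨h1, h2⟩ | ⟨h1, h2⟩)
      · exact ⟨h2.ne, h1⟩
      · exact ⟨h2.ne', h1⟩
  have hcard : T.card - 1 = A.card + B.card := by
    rw [← Finset.card_union_of_disjoint hdisj, ← hun, Finset.card_erase_of_mem hi]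
  have h1 : (A.card.factorial : ℝ) ≤ ∏ j ∈ A, |(i : ℝ) - j| := by
    have hinj : Set.InjOn (fun j => i - j) (A : Set ℕ) := by
      intro x hx y hy hxy
      simp only [hA, Finset.coe_filter, Set.mem_ofPred_eq] at hx hy
      dsimp only at hxy
      omega
    have := factorial_card_le_prod (A.image fun j => i - j) (by
      intro x hx
      obtain ⟨j, hj, rfl⟩ := Finset.mem_image.1 hx
      have := (Finset.mem_filter.1 hj).2
      omega)
    rw [Finset.card_image_of_injOn hinj, Finset.prod_image hinj] at this
    have h2 : ((∏ j ∈ A, (i - j) : ℕ) : ℝ) = ∏ j ∈ A, |(i : ℝ) - j| := by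
      rw [Nat.cast_prod]
      refine Finset.prod_congr rfl fun j hj => ?_
      have hj := (Finset.mem_filter.1 hj).2
      have : (j : ℝ) < i := by exact_mod_cast hj
      rw [Nat.cast_sub hj.le, abs_of_pos (by linarith)]
    rw [← h2]
    exact_mod_cast this
  have h1' : (B.card.factorial : ℝ) ≤ ∏ j ∈ B, |(i : ℝ) - j| := by
    have hinj : Set.InjOn (fun j => j - i) (B : Set ℕ) := by
      intro x hx y hy hxy
      simp only [hB, Finset.coe_filter, Set.mem_ofPred_eq] at hx hy
      dsimp only at hxy
      omega
    have := factorial_card_le_prod (B.image fun j => j - i) (by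
      intro x hx
      obtain ⟨j, hj, rfl⟩ := Finset.mem_image.1 hx
      have := (Finset.mem_filter.1 hj).2
      omega)
    rw [Finset.card_image_of_injOn hinj, Finset.prod_image hinj] at this
    have h2 : ((∏ j ∈ B, (j - i) : ℕ) : ℝ) = ∏ j ∈ B, |(i : ℝ) - j| := by
      rw [Nat.cast_prod]
      refine Finset.prod_congr rfl fun j hj => ?_
      have hj := (Finset.mem_filter.1 hj).2
      have : (i : ℝ) < j := by exact_mod_cast hj
      rw [Nat.cast_sub hj.le, abs_sub_comm, abs_of_pos (by linarith)]
    rw [← h2]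
    exact_mod_cast this
  rw [hun, Finset.prod_union hdisj, hcard]
  have h3 := Nat.add_choose_mul_factorial_mul_factorial A.card B.card
  have h4 : ((A.card + B.card).choose B.card : ℝ) ≤ 2 ^ (A.card + B.card) := by
    exact_mod_cast Nat.choose_le_two_pow _ _
  calc ((A.card + B.card).factorial : ℝ)
      = (A.card + B.card).choose B.card * (A.card.factorial * B.card.factorial) := by
        rw [← h3]; push_cast; ring
    _ ≤ 2 ^ (A.card + B.card) * ((∏ j ∈ A, |(i : ℝ) - j|) * ∏ j ∈ B, |(i : ℝ) - j|) := by
        gcongr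

/-- The constant in the interpolation bound `norm_eval_le_of_nodes`. -/
noncomputable def interpConst : ℝ := 16 * Real.exp 1

theorem interpConst_pos : 0 < interpConst := by unfold interpConst; positivity

/-- A polynomial of degree at most `d` bounded at `d + 1` of the nodes `1 + j / (d + 1)` is bounded
on the unit disc. -/
theorem norm_eval_le_of_nodes {d : ℕ} {q : Polynomial ℂ} (hq : q.natDegree ≤ d) {T : Finset ℕ}
    (hT : T ⊆ Finset.range (2 * d + 2)) (hcard : T.card = d + 1) {M : ℝ}
    (hM : ∀ j ∈ T, ‖q.eval ((1 + j / (d + 1) : ℝ) : ℂ)‖ ≤ M) {s : ℂ} (hs : ‖s‖ ≤ 1) :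
    ‖q.eval s‖ ≤ interpConst ^ (d + 1) * M := by
  set v : ℕ → ℂ := fun j => ((1 + j / (d + 1) : ℝ) : ℂ) with hv
  have hd0 : (0 : ℝ) < d + 1 := by positivity
  have hdiff : ∀ i j : ℕ, ‖v i - v j‖ = |(i : ℝ) - j| / (d + 1) := by
    intro i j
    rw [hv]
    dsimp only
    rw [← Complex.ofReal_sub, Complex.norm_real, Real.norm_eq_abs]
    rw [show (1 + (i : ℝ) / (d + 1) - (1 + j / (d + 1))) = (i - j) / (d + 1) by ring, abs_div,
      abs_of_pos hd0]
  have hinj : Set.InjOn v T := by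
    intro i _ j _ hij
    have h := hdiff i j
    rw [hij, sub_self, norm_zero] at h
    have h2 : |(i : ℝ) - j| = 0 := by
      have := (div_eq_zero_iff.1 h.symm).resolve_right hd0.ne'
      exact this
    have h3 := sub_eq_zero.1 (abs_eq_zero.1 h2)
    exact_mod_cast h3
  have hdeg : q.degree < T.card := by
    rw [hcard]
    refine (Polynomial.degree_le_natDegree).trans_lt ?_
    exact_mod_cast Nat.lt_succ_of_le hq
  have hM0 : 0 ≤ M := by
    obtain ⟨j, hj⟩ : T.Nonempty := Finset.card_pos.1 (by omega)
    exact (norm_nonneg _).trans (hM j hj)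
  -- Each factor is at most `4 (d + 1) / |i - j|`; the product is at most `8^d (d + 1)^d / d!`, and
  -- `(d + 1)^d / d! ≤ e^(d + 1)`.
  have hb : ∀ i ∈ T, ‖(Lagrange.basis T v i).eval s‖ ≤ 8 ^ d * Real.exp (d + 1) := by
    intro i hi
    rw [Lagrange.basis, Polynomial.eval_prod, norm_prod]
    have h1 : ∀ j ∈ T.erase i, ‖(Lagrange.basisDivisor (v i) (v j)).eval s‖ ≤
        4 * (d + 1) / |(i : ℝ) - j| := by
      intro j hj
      have hj' : j < 2 * d + 2 := Finset.mem_range.1 (hT (Finset.mem_of_mem_erase hj))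
      have hj2 : (j : ℝ) ≤ 2 * (d + 1) := by
        have : (j : ℝ) < 2 * d + 2 := by exact_mod_cast hj'
        linarith
      have hsv : ‖s - v j‖ ≤ 4 := by
        refine (norm_sub_le _ _).trans ?_
        have : ‖v j‖ ≤ 3 := by
          rw [hv]
          dsimp only
          rw [Complex.norm_real, Real.norm_of_nonneg (by positivity)]
          have : (j : ℝ) / (d + 1) ≤ 2 := by rw [div_le_iff₀ hd0]; exact hj2
          linarith
        linarith
      simp only [Lagrange.basisDivisor, Polynomial.eval_mul, Polynomial.eval_C,
        Polynomial.eval_sub, Polynomial.eval_X, norm_mul, norm_inv, hdiff]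
      rw [inv_div, div_mul_eq_mul_div, mul_comm]
      gcongr
    refine (Finset.prod_le_prod (fun _ _ => norm_nonneg _) h1).trans ?_
    rw [Finset.prod_div_distrib, Finset.prod_const, Finset.card_erase_of_mem hi, hcard,
      Nat.add_sub_cancel]
    have h2 := factorial_le_two_pow_mul_prod_dist T hi
    rw [hcard, Nat.add_sub_cancel] at h2
    have h3 := Real.pow_div_factorial_le_exp (d + 1 : ℝ) hd0.le d
    have hf : (0 : ℝ) < d.factorial := by positivity
    have hp : 0 < ∏ j ∈ T.erase i, |(i : ℝ) - j| := by
      refine Finset.prod_pos fun j hj => abs_pos.2 ?_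
      have : j ≠ i := (Finset.mem_erase.1 hj).1
      rw [sub_ne_zero]
      exact_mod_cast this.symm
    rw [div_le_iff₀ hf] at h3
    rw [div_le_iff₀ hp, mul_pow]
    calc (4 : ℝ) ^ d * (d + 1) ^ d ≤ 4 ^ d * (Real.exp (d + 1) *
          (2 ^ d * ∏ j ∈ T.erase i, |(i : ℝ) - j|)) := by
          gcongr
          exact h3.trans (by gcongr)
      _ = (4 * 2) ^ d * Real.exp (d + 1) * ∏ j ∈ T.erase i, |(i : ℝ) - j| := by
          rw [mul_pow]; ring
      _ = _ := by norm_num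
  rw [Lagrange.eq_interpolate hinj hdeg, Lagrange.interpolate_apply, Polynomial.eval_finsetSum]
  have h2d : ((d : ℝ) + 1) ≤ 2 ^ d := by exact_mod_cast Nat.lt_two_pow_self
  calc ‖∑ i ∈ T, (Polynomial.C (q.eval (v i)) * Lagrange.basis T v i).eval s‖
      ≤ ∑ i ∈ T, M * (8 ^ d * Real.exp (d + 1)) := by
        refine norm_sum_le_of_le _ fun i hi => ?_
        rw [Polynomial.eval_mul, Polynomial.eval_C, norm_mul]
        gcongr
        · exact hM i hi
        · exact hb i hi
    _ = (d + 1) * 8 ^ d * Real.exp (d + 1) * M := by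
        rw [Finset.sum_const, hcard, nsmul_eq_mul]; push_cast; ring
    _ ≤ 2 ^ d * 8 ^ d * Real.exp (d + 1) * M := by gcongr
    _ ≤ 16 ^ (d + 1) * Real.exp (d + 1) * M := by
        gcongr
        rw [← mul_pow]
        norm_num
        gcongr <;> norm_num
    _ = interpConst ^ (d + 1) * M := by
        rw [interpConst, mul_pow, ← Real.exp_nat_mul]; push_cast; simp

variable {E W : Type*} [NormedAddCommGroup E] [NormedSpace ℝ E]
  [NormedAddCommGroup W] [NormedSpace ℝ W]

/-- Complex coefficients are used so that Cauchy's estimate can bound derivatives along the line. -/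
theorem HPoly.exists_polynomial {d : ℕ} {F : E → W} (hF : F ∈ HPoly E W d) (φ : W →L[ℝ] ℝ)
    (x u : E) : ∃ q : Polynomial ℂ, q.natDegree ≤ d ∧
      ∀ t : ℝ, q.eval (t : ℂ) = (φ (F (x + t • u)) : ℝ) := by
  induction hF using Submodule.span_induction with
  | mem f hf =>
    obtain ⟨l, e, rfl⟩ := hf
    refine ⟨(Polynomial.C (l x : ℂ) + Polynomial.C (l u : ℂ) * Polynomial.X) ^ d *
      Polynomial.C (φ e : ℂ), ?_, fun t => ?_⟩
    · refine (Polynomial.natDegree_mul_C_le _ _).trans ?_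
      refine Polynomial.natDegree_pow_le.trans ?_
      have : (Polynomial.C (l x : ℂ) + Polynomial.C (l u : ℂ) * Polynomial.X).natDegree ≤ 1 := by
        rw [add_comm]
        exact Polynomial.natDegree_linear_le
      nlinarith
    · simp only [Polynomial.eval_mul, Polynomial.eval_pow, Polynomial.eval_add, Polynomial.eval_C,
        Polynomial.eval_X, map_smul, map_add, smul_eq_mul]
      push_cast
      ring
  | zero => exact ⟨0, by simp, by simp⟩
  | add f g _ _ hf hg =>
    obtain ⟨q, hq, h1⟩ := hf
    obtain ⟨q', hq', h1'⟩ := hg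
    exact ⟨q + q', (Polynomial.natDegree_add_le _ _).trans (max_le hq hq'), fun t => by
      simp [h1, h1']⟩
  | smul c f _ hf =>
    obtain ⟨q, hq, h1⟩ := hf
    exact ⟨Polynomial.C (c : ℂ) * q, (Polynomial.natDegree_C_mul_le _ _).trans hq, fun t => by
      simp [h1]⟩

/-- Restrict to the line through `x` and test with functionals. Interpolation bounds the polynomial
on the unit disc; the value is read off at `0` and the derivative from Cauchy's estimate on the unit
circle. -/
theorem HPoly.norm_le_of_nodes {d : ℕ} {F : E → W} (hF : F ∈ HPoly E W d) {x u : E}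
    {T : Finset ℕ} (hT : T ⊆ Finset.range (2 * d + 2)) (hcard : T.card = d + 1) {M : ℝ}
    (hM : ∀ j ∈ T, ‖F (x + (1 + j / (d + 1) : ℝ) • u)‖ ≤ M) :
    ‖F x‖ ≤ interpConst ^ (d + 1) * M ∧ ‖fderiv ℝ F x u‖ ≤ interpConst ^ (d + 1) * M := by
  have hM0 : 0 ≤ M := by
    obtain ⟨j, hj⟩ : T.Nonempty := Finset.card_pos.1 (by omega)
    exact (norm_nonneg _).trans (hM j hj)
  have hc := interpConst_pos
  have key : ∀ φ : W →L[ℝ] ℝ, ∃ q : Polynomial ℂ, (∀ t : ℝ, q.eval (t : ℂ) =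
      (φ (F (x + t • u)) : ℝ)) ∧ ∀ s : ℂ, ‖s‖ ≤ 1 →
        ‖q.eval s‖ ≤ interpConst ^ (d + 1) * M * ‖φ‖ := by
    intro φ
    obtain ⟨q, hq, h1⟩ := HPoly.exists_polynomial hF φ x u
    refine ⟨q, h1, fun s hs => ?_⟩
    rw [mul_assoc]
    refine norm_eval_le_of_nodes hq hT hcard (fun j hj => ?_) hs
    rw [h1, Complex.norm_real, mul_comm]
    refine (φ.le_opNorm _).trans ?_
    gcongr
    exact hM j hj
  constructor
  · refine NormedSpace.norm_le_dual_bound ℝ _ (by positivity) fun φ => ?_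
    obtain ⟨q, h1, h2⟩ := key φ
    have := h2 ((0 : ℝ) : ℂ) (by simp)
    rw [h1, Complex.norm_real] at this
    simpa using this
  · refine NormedSpace.norm_le_dual_bound ℝ _ (by positivity) fun φ => ?_
    obtain ⟨q, h1, h2⟩ := key φ
    have hd1 : HasDerivAt (fun t : ℝ => ((φ (F (x + t • u)) : ℝ) : ℂ))
        ((φ (fderiv ℝ F x u) : ℝ) : ℂ) 0 := by
      apply HasDerivAt.ofReal_comp
      have h3 : HasDerivAt (fun t : ℝ => x + t • u) u 0 := by
        simpa using ((hasDerivAt_id (0 : ℝ)).smul_const u).const_add x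
      have h4 : HasFDerivAt F (fderiv ℝ F x) (x + (0 : ℝ) • u) := by
        simpa using (HPoly.differentiable hF x).hasFDerivAt
      exact φ.hasFDerivAt.comp_hasDerivAt (0 : ℝ) (h4.comp_hasDerivAt (0 : ℝ) h3)
    have hd2 : HasDerivAt (fun t : ℝ => q.eval (t : ℂ)) (q.derivative.eval ((0 : ℝ) : ℂ)) 0 :=
      (q.hasDerivAt ((0 : ℝ) : ℂ)).comp_ofReal
    have heq : (fun t : ℝ => q.eval (t : ℂ)) = fun t : ℝ => ((φ (F (x + t • u)) : ℝ) : ℂ) :=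
      funext h1
    rw [heq] at hd2
    have h5 := hd1.unique hd2
    have h6 := Complex.norm_deriv_le_of_forall_mem_sphere_norm_le (c := 0) (R := 1)
      (f := fun s => q.eval s) one_pos q.differentiable.diffContOnCl
      (fun z hz => h2 z (by simpa using (mem_sphere_zero_iff_norm.1 hz).le))
    rw [Polynomial.deriv, div_one] at h6
    rw [← Complex.norm_real, h5]
    simpa using h6

end PolynomialBounds

/-! ### From pointwise convergence to geometric bounds on balls. -/

section SeriesBounds

open Filter Topology MeasureTheory

variable {E W : Type*} [NormedAddCommGroup E] [NormedSpace ℝ E] [FiniteDimensional ℝ E]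
  [NormedAddCommGroup W] [NormedSpace ℝ W]

/-- If `B` is small in measure, every point of the unit ball has a ray containing at least `d + 1`
of the first `2 d + 2` equispaced nodes outside `B`. -/
theorem exists_nodes_notMem [MeasurableSpace E] [BorelSpace E] (μ : Measure E)
    [μ.IsAddHaarMeasure] {B : Set E} (hB : MeasurableSet B) (hμ : 2 * μ B ≤ μ (Metric.ball 0 1))
    (d : ℕ) (x : E) : ∃ u ∈ Metric.ball (0 : E) 1, ∃ T ⊆ Finset.range (2 * d + 2),
      T.card = d + 1 ∧ ∀ j ∈ T, x + (1 + j / (d + 1) : ℝ) • u ∉ B := by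
  classical
  set r : ℕ → ℝ := fun j => 1 + j / (d + 1) with hr
  have hr1 : ∀ j, 1 ≤ r j := fun j => by
    have : (0 : ℝ) ≤ j / (d + 1) := by positivity
    simp only [hr]; linarith
  set S : ℕ → Set E := fun j => (fun u => r j • u) ⁻¹' ((fun y => x + y) ⁻¹' B) with hS
  have hSm : ∀ j, MeasurableSet (S j) := fun j =>
    (measurable_const_smul (r j)) ((measurable_const_add x) hB)
  have hSμ : ∀ j, μ (S j) ≤ μ B := by
    intro j
    have h0 : r j ≠ 0 := by have := hr1 j; linarith
    rw [hS]
    dsimp only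
    rw [Measure.addHaar_preimage_smul μ h0, measure_preimage_add]
    have : ENNReal.ofReal |(r j ^ Module.finrank ℝ E)⁻¹| ≤ 1 := by
      rw [ENNReal.ofReal_le_one, abs_of_pos (by have := hr1 j; positivity)]
      exact inv_le_one_of_one_le₀ (one_le_pow₀ (hr1 j))
    calc _ ≤ 1 * μ B := by gcongr
      _ = μ B := one_mul _
  suffices h : ∃ u ∈ Metric.ball (0 : E) 1,
      d + 1 ≤ ((Finset.range (2 * d + 2)).filter fun j => u ∉ S j).card by
    obtain ⟨u, hu, hc⟩ := h
    obtain ⟨T, hT, hTc⟩ := Finset.exists_subset_card_eq hc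
    exact ⟨u, hu, T, hT.trans (Finset.filter_subset _ _), hTc, fun j hj =>
      (Finset.mem_filter.1 (hT hj)).2⟩
  -- Otherwise every `u` in the ball lies in at least `d + 2` of the `2 d + 2` sets `S j`.
  -- Integrating gives `(d + 2) μ(ball) ≤ (2 d + 2) μ(B) ≤ (d + 1) μ(ball)`.
  by_contra! hcon
  have hbad : ∀ u ∈ Metric.ball (0 : E) 1, ((d + 2 : ℕ) : ENNReal) ≤
      ∑ j ∈ Finset.range (2 * d + 2), (S j).indicator 1 u := by
    intro u hu
    have h1 := hcon u hu
    have h2 := Finset.card_filter_add_card_filter_not (s := Finset.range (2 * d + 2))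
      (fun j => u ∈ S j)
    rw [Finset.card_range] at h2
    have h3 : d + 2 ≤ ((Finset.range (2 * d + 2)).filter fun j => u ∈ S j).card := by omega
    have h4 : ∑ j ∈ Finset.range (2 * d + 2), (S j).indicator (1 : E → ENNReal) u =
        (((Finset.range (2 * d + 2)).filter fun j => u ∈ S j).card : ENNReal) := by
      simp [Set.indicator_apply]
    rw [h4]
    exact_mod_cast h3
  have h1 : ((d + 2 : ℕ) : ENNReal) * μ (Metric.ball 0 1) ≤ (d + 1 : ℕ) * μ (Metric.ball 0 1) :=
    calc ((d + 2 : ℕ) : ENNReal) * μ (Metric.ball 0 1)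
        = ∫⁻ _ in Metric.ball (0 : E) 1, ((d + 2 : ℕ) : ENNReal) ∂μ := by
          rw [setLIntegral_const]
      _ ≤ ∫⁻ u in Metric.ball (0 : E) 1,
            ∑ j ∈ Finset.range (2 * d + 2), (S j).indicator 1 u ∂μ :=
          setLIntegral_mono' measurableSet_ball hbad
      _ ≤ ∫⁻ u, ∑ j ∈ Finset.range (2 * d + 2), (S j).indicator 1 u ∂μ :=
          setLIntegral_le_lintegral _ _
      _ = ∑ j ∈ Finset.range (2 * d + 2), μ (S j) := by
          rw [lintegral_finsetSum _ fun j _ => measurable_one.indicator (hSm j)]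
          exact Finset.sum_congr rfl fun j _ => lintegral_indicator_one (hSm j)
      _ ≤ ∑ _j ∈ Finset.range (2 * d + 2), μ B := Finset.sum_le_sum fun j _ => hSμ j
      _ = (d + 1 : ℕ) * (2 * μ B) := by
          rw [Finset.sum_const, Finset.card_range, nsmul_eq_mul]
          push_cast
          ring
      _ ≤ (d + 1 : ℕ) * μ (Metric.ball 0 1) := by gcongr
  have hfin : μ (Metric.ball (0 : E) 1) ≠ ⊤ := measure_ball_lt_top.ne
  have hpos : μ (Metric.ball (0 : E) 1) ≠ 0 := (Metric.measure_ball_pos μ _ one_pos).ne'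
  have h2 := (ENNReal.mul_le_mul_iff_left hpos hfin).1 h1
  have h3 : d + 2 ≤ d + 1 := by exact_mod_cast h2
  omega

/-- The points where some term of degree at least `D` is large form sets decreasing to the empty
set, hence of small measure. Every point of the unit ball then sees enough good nodes along some
line, and interpolation transfers the bound to it. The finitely many remaining degrees are bounded
by compactness. -/
theorem exists_bound_unit_ball {F : ℕ → E → W} (hF : ∀ d, F d ∈ HPoly E W d)
    (hsum : ∀ p, Summable fun d => ‖F d p‖) {ρ : ℝ} (hρ : 0 < ρ) :
    ∃ C, 0 ≤ C ∧ ∀ d, ∀ p : E, ‖p‖ ≤ 1 → ‖F d p‖ ≤ C * ρ ^ d := by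
  let _ : MeasurableSpace E := borel E
  have _ : BorelSpace E := ⟨rfl⟩
  let μ : Measure E := Measure.addHaar
  have hA := interpConst_pos
  -- This absorbs the factor `interpConst ^ (d + 1)` lost in interpolation, up to one power. Below,
  -- the radius `4` contains all nodes `p + r u` with `‖p‖, ‖u‖ ≤ 1` and `r ≤ 3`.
  set σ := ρ / interpConst with hσ
  have hσ0 : 0 < σ := by positivity
  set B : ℕ → Set E := fun D =>
    Metric.closedBall 0 4 ∩ ⋃ d ∈ Set.Ici D, {y | σ ^ d < ‖F d y‖} with hB
  have hBm : ∀ D, MeasurableSet (B D) := fun D =>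
    Metric.isClosed_closedBall.measurableSet.inter
      (isOpen_biUnion fun d _ =>
        isOpen_lt continuous_const (HPoly.continuous (hF d)).norm).measurableSet
  have hBanti : Antitone B := fun D D' h =>
    Set.inter_subset_inter_right _ (Set.biUnion_subset_biUnion_left (Set.Ici_subset_Ici.2 h))
  have hBempty : ⋂ D, B D = ∅ := by
    rw [Set.eq_empty_iff_forall_notMem]
    intro y hy
    -- By homogeneity, terms tending to `0` at `σ⁻¹ y` are eventually at most `σ^d` at `y`.
    have h1 := (hsum (σ⁻¹ • y)).tendsto_atTop_zero
    obtain ⟨D, hD⟩ := eventually_atTop.1 (h1.eventually_le_const one_pos)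
    have h2 := Set.mem_iInter.1 hy D
    obtain ⟨d, hd, h3⟩ := Set.mem_iUnion₂.1 h2.2
    have h4 := hD d hd
    rw [HPoly.apply_smul (hF d), norm_smul, norm_pow, Real.norm_of_nonneg (by positivity),
      inv_pow, inv_mul_le_iff₀ (by positivity), mul_one] at h4
    exact absurd h3 (not_lt.2 h4)
  have hlim := tendsto_measure_iInter_atTop (μ := μ) (fun D => (hBm D).nullMeasurableSet) hBanti
    ⟨0, ((measure_mono Set.inter_subset_left).trans_lt measure_closedBall_lt_top).ne⟩
  rw [hBempty, measure_empty] at hlim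
  have hpos : 0 < μ (Metric.ball (0 : E) 1) := Metric.measure_ball_pos μ _ one_pos
  obtain ⟨D, hD⟩ := (hlim.eventually_lt_const (ENNReal.half_pos hpos.ne')).exists
  have hD' : 2 * μ (B D) ≤ μ (Metric.ball 0 1) := by
    calc 2 * μ (B D) ≤ 2 * (μ (Metric.ball 0 1) / 2) := by gcongr; exact hD.le
      _ = _ := ENNReal.mul_div_cancel (by norm_num) (by norm_num)
  have hlarge : ∀ d, D ≤ d → ∀ p : E, ‖p‖ ≤ 1 → ‖F d p‖ ≤ interpConst * ρ ^ d := by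
    intro d hd p hp
    obtain ⟨u, hu, T, hT, hTc, hTB⟩ := exists_nodes_notMem μ (hBm D) hD' d p
    have h1 := (HPoly.norm_le_of_nodes (hF d) (x := p) (u := u) hT hTc (M := σ ^ d) (by
      intro j hj
      have hj' : j < 2 * d + 2 := Finset.mem_range.1 (hT hj)
      have hj2 : (j : ℝ) / (d + 1) ≤ 2 := by
        rw [div_le_iff₀ (by positivity)]
        have : (j : ℝ) < 2 * d + 2 := by exact_mod_cast hj'
        linarith
      have hu' : ‖u‖ < 1 := mem_ball_zero_iff.1 hu
      by_contra! hlt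
      refine hTB j hj ⟨?_, Set.mem_biUnion (show d ∈ Set.Ici D from hd) hlt⟩
      rw [mem_closedBall_zero_iff]
      have hj0 : (0 : ℝ) ≤ j / (d + 1) := by positivity
      calc ‖p + (1 + j / (d + 1) : ℝ) • u‖ ≤ ‖p‖ + (1 + j / (d + 1)) * ‖u‖ := by
            refine (norm_add_le _ _).trans ?_
            rw [norm_smul, Real.norm_of_nonneg (by positivity)]
        _ ≤ 1 + (1 + 2) * 1 := by gcongr
        _ = 4 := by norm_num)).1
    refine h1.trans (le_of_eq ?_)
    rw [hσ, div_pow, pow_succ]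
    field_simp
  have hbd : ∀ d, ∃ M, 0 ≤ M ∧ ∀ p : E, ‖p‖ ≤ 1 → ‖F d p‖ ≤ M := by
    intro d
    obtain ⟨M, hM⟩ := (isCompact_closedBall (0 : E) 1).exists_bound_of_continuousOn
      (HPoly.continuous (hF d)).continuousOn
    exact ⟨M, (norm_nonneg _).trans (hM 0 (by simp)), fun p hp => hM p (by simpa using hp)⟩
  choose M hM0 hM using hbd
  refine ⟨interpConst + ∑ d ∈ Finset.range D, M d / ρ ^ d, ?_, fun d p hp => ?_⟩
  · have : 0 ≤ ∑ d ∈ Finset.range D, M d / ρ ^ d :=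
      Finset.sum_nonneg fun d _ => div_nonneg (hM0 d) (by positivity)
    positivity
  · rcases le_or_gt D d with hd | hd
    · refine (hlarge d hd p hp).trans ?_
      gcongr
      simpa using Finset.sum_nonneg fun d _ => div_nonneg (hM0 d) (by positivity)
    · refine (hM d p hp).trans ?_
      rw [← div_le_iff₀ (by positivity)]
      have := Finset.single_le_sum (f := fun d => M d / ρ ^ d)
        (fun d _ => div_nonneg (hM0 d) (by positivity)) (Finset.mem_range.2 hd)
      linarith

theorem exists_bound_ball {F : ℕ → E → W} (hF : ∀ d, F d ∈ HPoly E W d)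
    (hsum : ∀ p, Summable fun d => ‖F d p‖) {R ρ : ℝ} (hR : 0 < R) (hρ : 0 < ρ) :
    ∃ C, 0 ≤ C ∧ ∀ d, ∀ p : E, ‖p‖ ≤ R → ‖F d p‖ ≤ C * ρ ^ d := by
  obtain ⟨C, hC0, hC⟩ := exists_bound_unit_ball hF hsum (ρ := ρ / R) (by positivity)
  refine ⟨C, hC0, fun d p hp => ?_⟩
  have h1 := hC d (R⁻¹ • p) (by
    rw [norm_smul, Real.norm_of_nonneg (by positivity), inv_mul_le_iff₀ hR]
    simpa using hp)
  rw [HPoly.apply_smul (hF d), norm_smul, Real.norm_of_nonneg (by positivity), inv_pow,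
    inv_mul_le_iff₀ (by positivity), div_pow] at h1
  refine h1.trans (le_of_eq ?_)
  field_simp

/-- The bound on the ball of radius `R + 3` holds at every node, so the first `d + 1` nodes serve
for the derivative estimate. -/
theorem exists_bound_fderiv_ball {F : ℕ → E → W} (hF : ∀ d, F d ∈ HPoly E W d)
    (hsum : ∀ p, Summable fun d => ‖F d p‖) {R ρ : ℝ} (hR : 0 < R) (hρ : 0 < ρ) :
    ∃ C, 0 ≤ C ∧ ∀ d, ∀ p : E, ‖p‖ ≤ R → ‖fderiv ℝ (F d) p‖ ≤ C * ρ ^ d := by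
  have hA := interpConst_pos
  obtain ⟨C, hC0, hC⟩ := exists_bound_ball hF hsum (R := R + 3) (ρ := ρ / interpConst)
    (by positivity) (by positivity)
  refine ⟨interpConst * C, by positivity, fun d p hp => ?_⟩
  refine ContinuousLinearMap.opNorm_le_of_unit_norm (by positivity) fun u hu => ?_
  have h1 := (HPoly.norm_le_of_nodes (hF d) (x := p) (u := u) (T := Finset.range (d + 1))
    (Finset.range_subset_range.2 (by omega)) (by simp) (M := C * (ρ / interpConst) ^ d) (by
      intro j hj
      refine hC d _ ?_
      have hj2 : (j : ℝ) / (d + 1) ≤ 2 := by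
        rw [div_le_iff₀ (by positivity)]
        have : (j : ℝ) < d + 1 := by exact_mod_cast Finset.mem_range.1 hj
        linarith
      have hj0 : (0 : ℝ) ≤ j / (d + 1) := by positivity
      refine (norm_add_le _ _).trans ?_
      rw [norm_smul, Real.norm_of_nonneg (by positivity), hu]
      linarith)).2
  refine h1.trans (le_of_eq ?_)
  rw [div_pow, pow_succ]
  field_simp

end SeriesBounds

/-! ### Sums of homogeneous series and termwise divergence. -/

section EntireSeries

open Filter Topology

/-- If the earlier coefficients vanish, dividing by `t^n` shows that `c n` is `O(t)` as `t → 0+`. -/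
theorem eq_zero_of_hasSum_pow_mul_eq_zero {c : ℕ → ℝ}
    (h : ∀ t : ℝ, HasSum (fun n => t ^ n * c n) 0) (n : ℕ) : c n = 0 := by
  induction n using Nat.strong_induction_on with
  | _ n ih =>
  have hs : Summable fun m => |c (m + (n + 1))| := by
    have h1 : Summable fun m => |c m| := by
      have := (h 1).summable.abs
      simpa using this
    exact (summable_nat_add_iff (f := fun m => |c m|) (n + 1)).2 h1
  have hb : ∀ t : ℝ, 0 < t → t ≤ 1 → |c n| ≤ t * ∑' m, |c (m + (n + 1))| := by
    intro t ht ht1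
    have h1 := (hasSum_nat_add_iff' (f := fun m => t ^ m * c m) (n + 1)).2 (h t)
    have h0 : ∑ i ∈ Finset.range n, t ^ i * c i = 0 :=
      Finset.sum_eq_zero fun i hi => by rw [ih i (Finset.mem_range.1 hi), mul_zero]
    rw [Finset.sum_range_succ, h0, zero_add, zero_sub] at h1
    have h2 := h1.mul_left (t ^ n)⁻¹
    have h3 : (t ^ n)⁻¹ * -(t ^ n * c n) = -c n := by field_simp
    rw [h3] at h2
    rw [← abs_neg, ← Real.norm_eq_abs, ← h2.tsum_eq, ← tsum_mul_left]
    refine tsum_of_norm_bounded (hs.mul_left t).hasSum fun m => ?_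
    rw [Real.norm_eq_abs, abs_mul, abs_mul, abs_of_pos (by positivity : 0 < (t ^ n)⁻¹),
      abs_of_pos (by positivity : 0 < t ^ (m + (n + 1))), ← mul_assoc]
    gcongr
    rw [show t ^ (m + (n + 1)) = t ^ n * (t ^ m * t) by ring, inv_mul_cancel_left₀ (by positivity)]
    exact mul_le_of_le_one_left ht.le (pow_le_one₀ ht.le ht1)
  have hlim : Tendsto (fun t : ℝ => t * ∑' m, |c (m + (n + 1))|) (𝓝[>] 0) (𝓝 0) := by
    apply Tendsto.mono_left _ nhdsWithin_le_nhds
    have : Continuous fun t : ℝ => t * ∑' m, |c (m + (n + 1))| := by fun_prop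
    simpa using this.tendsto 0
  have hev : ∀ᶠ t : ℝ in 𝓝[>] 0, |c n| ≤ t * ∑' m, |c (m + (n + 1))| := by
    filter_upwards [Ioc_mem_nhdsGT one_pos] with t ht
    exact hb t ht.1 ht.2
  exact abs_eq_zero.1 (le_antisymm (ge_of_tendsto hlim hev) (abs_nonneg _))

variable {E W : Type*} [NormedAddCommGroup E] [NormedSpace ℝ E] [FiniteDimensional ℝ E]
  [NormedAddCommGroup W] [NormedSpace ℝ W] [CompleteSpace W]

/-- `f` is the pointwise absolutely convergent sum of the homogeneous polynomial maps `F d`. -/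
structure IsHomogeneousExpansion (F : ℕ → E → W) (f : E → W) : Prop where
  mem : ∀ d, F d ∈ HPoly E W d
  summable : ∀ p, Summable fun d => ‖F d p‖
  hasSum : ∀ p, HasSum (fun d => F d p) (f p)

namespace IsHomogeneousExpansion

variable {F : ℕ → E → W} {f : E → W}

theorem summable_fderiv (h : IsHomogeneousExpansion F f) (p : E) :
    Summable fun d => fderiv ℝ (F d) p := by
  obtain ⟨C, _, hC⟩ := exists_bound_fderiv_ball h.mem h.summable (R := ‖p‖ + 1) (ρ := 1 / 2)
    (by positivity) (by norm_num)
  exact Summable.of_norm_bounded (summable_geometric_two.mul_left C)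
    fun d => hC d p (by linarith)

theorem hasFDerivAt (h : IsHomogeneousExpansion F f) (p : E) :
    HasFDerivAt f (∑' d, fderiv ℝ (F d) p) p := by
  obtain ⟨C, _, hC⟩ := exists_bound_fderiv_ball h.mem h.summable (R := ‖p‖ + 1) (ρ := 1 / 2)
    (by positivity) (by norm_num)
  have h1 := hasFDerivAt_tsum_of_isPreconnected (summable_geometric_two.mul_left C)
    (s := Metric.ball (0 : E) (‖p‖ + 1)) Metric.isOpen_ball
    (convex_ball (0 : E) _).isPreconnected (f := F) (f' := fun d => fderiv ℝ (F d))
    (fun d x _ => (HPoly.differentiable (h.mem d) x).hasFDerivAt)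
    (fun d x hx => hC d x (mem_ball_zero_iff.1 hx).le) (x₀ := p) (x := p)
    (by simp) (h.hasSum p).summable (by simp)
  have h2 : f = fun y => ∑' d, F d y := funext fun y => (h.hasSum y).tsum_eq.symm
  rw [h2]
  exact h1

theorem continuous (h : IsHomogeneousExpansion F f) : Continuous f :=
  continuous_iff_continuousAt.2 fun p => (h.hasFDerivAt p).continuousAt

theorem exists_lipschitzOnWith (h : IsHomogeneousExpansion F f) (R : ℝ) :
    ∃ C : NNReal, LipschitzOnWith C f (Metric.closedBall 0 R) := by
  obtain ⟨C, hC0, hC⟩ := exists_bound_fderiv_ball h.mem h.summable (R := |R| + 1) (ρ := 1 / 2)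
    (by positivity) (by norm_num)
  refine ⟨(C * 2).toNNReal, ?_⟩
  refine (convex_closedBall (0 : E) R).lipschitzOnWith_of_nnnorm_hasFDerivWithin_le
    (f' := fun p => ∑' d, fderiv ℝ (F d) p) (fun p _ => (h.hasFDerivAt p).hasFDerivWithinAt)
    fun p hp => ?_
  rw [← NNReal.coe_le_coe, Real.coe_toNNReal _ (by positivity)]
  refine tsum_of_norm_bounded (hasSum_geometric_two.mul_left C) fun d => hC d p ?_
  have := mem_closedBall_zero_iff.1 hp
  linarith [le_abs_self R]

theorem exists_partial_sum (h : IsHomogeneousExpansion F f) {K : Set E} (hK : IsCompact K)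
    {ε : ℝ} (hε : 0 < ε) :
    ∃ n, ∀ p ∈ K, ‖f p - (∑ d ∈ Finset.range n, F d) p‖ ≤ ε := by
  obtain ⟨R, hR⟩ := hK.isBounded.exists_norm_le
  obtain ⟨C, hC0, hC⟩ := exists_bound_ball h.mem h.summable (R := |R| + 1) (ρ := 1 / 2)
    (by positivity) (by norm_num)
  have hu := tendstoUniformlyOn_tsum_nat (f := F) (u := fun d => C * (1 / 2) ^ d) (s := K)
    (summable_geometric_two.mul_left C)
    (fun d p hp => hC d p (by linarith [hR p hp, le_abs_self R]))
  obtain ⟨n, hn⟩ := (Metric.tendstoUniformlyOn_iff.1 hu ε hε).exists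
  refine ⟨n, fun p hp => ?_⟩
  have := hn p hp
  rw [(h.hasSum p).tsum_eq, dist_eq_norm] at this
  simpa using this.le

end IsHomogeneousExpansion

theorem realDiv_mem {d : ℕ} {X : E → E} (hX : X ∈ HPoly E E d) :
    realDiv X ∈ HPoly E ℝ (d - 1) := by
  let b := Module.finBasis ℝ E
  have h : realDiv X = ∑ i, fun p =>
      LinearMap.toContinuousLinearMap (b.coord i) (fderiv ℝ X p (b i)) := by
    ext p
    rw [realDiv, trace_eq_sum_coord b, Finset.sum_apply]
    rfl
  rw [h]
  exact Submodule.sum_mem _ fun i _ => HPoly.clm_comp_mem _ (HPoly.fderiv_mem hX _)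

/-- The divergence may be taken termwise; along the ray through `p` it becomes a power series in `t`
that vanishes identically. -/
theorem IsHomogeneousExpansion.realDiv_eq_zero {F : ℕ → E → E} {X : E → E}
    (h : IsHomogeneousExpansion F X) (hdiv : ∀ p, realDiv X p = 0) (d : ℕ) (p : E) :
    realDiv (F d) p = 0 := by
  have h0 : ∀ p, realDiv (F 0) p = 0 := by
    intro p
    have h1 : ∀ v, fderiv ℝ (F 0) p v = 0 := by
      intro v
      have h2 : F 0 = fun _ => F 0 0 := by
        funext x
        have := HPoly.apply_smul (h.mem 0) 0 x
        rw [zero_smul, pow_zero, one_smul] at this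
        exact this.symm
      rw [h2]
      simp
    have h2 : fderiv ℝ (F 0) p = 0 := ContinuousLinearMap.ext h1
    rw [realDiv, h2]
    simp
  have hsum : ∀ q, HasSum (fun d => realDiv (F d) q) 0 := by
    intro q
    let tr : (E →L[ℝ] E) →ₗ[ℝ] ℝ := LinearMap.trace ℝ E ∘ₗ ContinuousLinearMap.coeLM ℝ
    have h1 := (h.summable_fderiv q).hasSum
    rw [← (h.hasFDerivAt q).fderiv] at h1
    have h2 := h1.mapL (LinearMap.toContinuousLinearMap tr)
    rw [← hdiv q]
    exact h2
  refine eq_zero_of_hasSum_pow_mul_eq_zero (c := fun d => realDiv (F d) p) (fun t => ?_) d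
  -- The extra factor `t` turns `t^(d - 1)` into `t^d`; the term `d = 0`, where the subtraction
  -- truncates, is zero by `h0`.
  have h1 := (hsum (t • p)).mul_left t
  rw [mul_zero] at h1
  refine (congrArg (HasSum · 0) (funext fun d => ?_)).mp h1
  rcases d with _ | d
  · simp [h0]
  · rw [HPoly.apply_smul (realDiv_mem (h.mem (d + 1))), Nat.add_sub_cancel, smul_eq_mul]
    ring

end EntireSeries

/-! ### Real-linear shears and the first generated fields. -/

section Shears

open Filter Topology

theorem isMapMonoid_finiteCompositions (S : Set (QuatPlane → QuatPlane)) :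
    IsMapMonoid (finiteCompositions S) where
  id_mem := ⟨[], by simp, rfl⟩
  comp_mem := by
    rintro _ _ ⟨l, hl, rfl⟩ ⟨l', hl', rfl⟩
    refine ⟨l ++ l', fun s hs => (List.mem_append.1 hs).elim (hl s) (hl' s), ?_⟩
    induction l with
    | nil => rfl
    | cons a l ih =>
      rw [List.cons_append, List.foldr_cons, List.foldr_cons,
        ← ih fun s hs => hl s (List.mem_cons_of_mem _ hs)]
      rfl

theorem subset_finiteCompositions (S : Set (QuatPlane → QuatPlane)) :
    S ⊆ finiteCompositions S := fun s hs => ⟨[s], by simpa using hs, rfl⟩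

theorem sliceRegular_pow_mul (n : ℕ) (a : ℍ[ℝ]) : SliceRegular fun q => q ^ n * a := by
  refine ⟨fun m => if m = n then a else 0, fun q => ?_⟩
  have h := hasSum_single (f := fun m => q ^ m * (if m = n then a else 0)) n (by
    intro m hm
    simp [hm])
  simpa using h

theorem SliceRegular.add {f g : ℍ[ℝ] → ℍ[ℝ]} (hf : SliceRegular f) (hg : SliceRegular g) :
    SliceRegular (f + g) := by
  obtain ⟨a, ha⟩ := hf
  obtain ⟨b, hb⟩ := hg
  refine ⟨a + b, fun q => ?_⟩
  simpa [mul_add] using (ha q).add (hb q)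

/-- The map `(z, w) ↦ (z + f(w), w)`. -/
noncomputable def upperShear (f : ℍ[ℝ] → ℍ[ℝ]) (p : QuatPlane) : QuatPlane := (p.1 + f p.2, p.2)

/-- The map `(z, w) ↦ (z, w + f(z))`. -/
noncomputable def lowerShear (f : ℍ[ℝ] → ℍ[ℝ]) (p : QuatPlane) : QuatPlane := (p.1, p.2 + f p.1)

theorem upperShear_mem_shears {f : ℍ[ℝ] → ℍ[ℝ]} (hf : SliceRegular f) :
    upperShear f ∈ shears :=
  ⟨0, 1, 1, 0, f, by norm_num, by norm_num, hf, fun z w => by simp [upperShear]⟩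

theorem lowerShear_mem_shears {f : ℍ[ℝ] → ℍ[ℝ]} (hf : SliceRegular f) :
    lowerShear f ∈ shears :=
  ⟨1, 0, 0, 1, f, by norm_num, by norm_num, hf, fun z w => by simp [lowerShear]⟩

variable {G : Set (QuatPlane → QuatPlane)}

theorem upperShear_add_mem (hG : IsMapMonoid G) {f g : ℍ[ℝ] → ℍ[ℝ]} (hf : upperShear f ∈ G)
    (hg : upperShear g ∈ G) : upperShear (f + g) ∈ G := by
  have := hG.comp_mem hf hg
  convert this using 1
  ext1 p
  simp only [upperShear, Function.comp, Pi.add_apply]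
  rw [add_assoc, add_comm (g p.2)]

/-- Conjugation by a translation of `w`. Since `q ↦ f(q + c)` need not be slice-regular, this leaves
the original class of shears. -/
theorem upperShear_translate_mem (hG : IsMapMonoid G) (hS : shears ⊆ G) {f : ℍ[ℝ] → ℍ[ℝ]}
    (hf : upperShear f ∈ G) (c : ℍ[ℝ]) : upperShear (fun q => f (q + c)) ∈ G := by
  have h1 : ∀ c : ℍ[ℝ], lowerShear (fun _ => c) ∈ G := fun c => by
    simpa using hS (lowerShear_mem_shears (sliceRegular_pow_mul 0 c))
  have := hG.comp_mem (h1 (-c)) (hG.comp_mem hf (h1 c))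
  convert this using 1
  ext1 p
  simp [upperShear, lowerShear]

/-- In `(q + c)² a = q² a + q c a + c q a + c² a` every term but `c q a` is slice-regular and can be
removed. -/
theorem upperShear_mul_mul_mem (hG : IsMapMonoid G) (hS : shears ⊆ G) (c a : ℍ[ℝ]) :
    upperShear (fun q => c * q * a) ∈ G := by
  have h1 := upperShear_translate_mem hG hS (hS (upperShear_mem_shears
    (sliceRegular_pow_mul 2 a))) c
  have h2 := hS (upperShear_mem_shears (((sliceRegular_pow_mul 2 (-a)).add
    (sliceRegular_pow_mul 1 (-(c * a)))).add (sliceRegular_pow_mul 0 (-(c ^ 2 * a)))))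
  have := upperShear_add_mem hG h1 h2
  convert this using 2
  ext1 q
  simp only [Pi.add_apply]
  noncomm_ring

/-- The quaternion unit `i`. -/
noncomputable def quatI : ℍ[ℝ] := ⟨0, 1, 0, 0⟩

/-- The quaternion unit `j`. -/
noncomputable def quatJ : ℍ[ℝ] := ⟨0, 0, 1, 0⟩

/-- The quaternion unit `k`. -/
noncomputable def quatK : ℍ[ℝ] := ⟨0, 0, 0, 1⟩

@[simp] theorem quatI_re : quatI.re = 0 := rfl

@[simp] theorem quatI_imI : quatI.imI = 1 := rfl

@[simp] theorem quatI_imJ : quatI.imJ = 0 := rfl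

@[simp] theorem quatI_imK : quatI.imK = 0 := rfl

@[simp] theorem quatJ_re : quatJ.re = 0 := rfl

@[simp] theorem quatJ_imI : quatJ.imI = 0 := rfl

@[simp] theorem quatJ_imJ : quatJ.imJ = 1 := rfl

@[simp] theorem quatJ_imK : quatJ.imK = 0 := rfl

@[simp] theorem quatK_re : quatK.re = 0 := rfl

@[simp] theorem quatK_imI : quatK.imI = 0 := rfl

@[simp] theorem quatK_imJ : quatK.imJ = 0 := rfl

@[simp] theorem quatK_imK : quatK.imK = 1 := rfl

theorem quaternion_coe_re (x : ℍ[ℝ]) : ((x.re : ℝ) : ℍ[ℝ]) = (1 / 4 : ℝ) •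
    (x - quatI * x * quatI - quatJ * x * quatJ
      - quatK * x * quatK) := by
  ext
  · simp
    ring
  all_goals simp

/-- The real part is a combination of two-sided multiplications, `4 Re x = x - i x i - j x j - k x
k`. Hence all real coordinates of `q` become available. -/
theorem upperShear_re_mul_mem (hG : IsMapMonoid G) (hS : shears ⊆ G) (c a : ℍ[ℝ]) :
    upperShear (fun q => (((c * q).re : ℝ) : ℍ[ℝ]) * a) ∈ G := by
  have h := fun c a => upperShear_mul_mul_mem hG hS c a
  have := upperShear_add_mem hG (upperShear_add_mem hG (upperShear_add_mem hG
    (h ((1 / 4 : ℝ) • c) a)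
    (h ((-1 / 4 : ℝ) • (quatI * c)) (quatI * a)))
    (h ((-1 / 4 : ℝ) • (quatJ * c)) (quatJ * a)))
    (h ((-1 / 4 : ℝ) • (quatK * c)) (quatK * a))
  convert this using 2
  ext1 q
  rw [quaternion_coe_re]
  simp only [Pi.add_apply, smul_mul_assoc, sub_mul, smul_sub, mul_assoc]
  simp only [neg_div, neg_smul]
  abel

theorem upperShear_linear_mem (hG : IsMapMonoid G) (hS : shears ⊆ G) (M : ℍ[ℝ] →L[ℝ] ℍ[ℝ]) :
    upperShear M ∈ G := by
  have h := fun c a => upperShear_re_mul_mem hG hS c a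
  have := upperShear_add_mem hG (upperShear_add_mem hG (upperShear_add_mem hG
    (h 1 (M 1)) (h (-quatI) (M quatI)))
    (h (-quatJ) (M quatJ))) (h (-quatK) (M quatK))
  convert this using 2
  ext1 q
  have hq : q = q.re • (1 : ℍ[ℝ]) + q.imI • quatI
      + q.imJ • quatJ + q.imK • quatK := by
    ext <;> simp
  conv_lhs => rw [hq]
  simp only [map_add, map_smul, Pi.add_apply, Quaternion.coe_mul_eq_smul]
  simp

theorem swap_conj_mem_shears {S : QuatPlane → QuatPlane} (hS : S ∈ shears) :
    Prod.swap ∘ S ∘ Prod.swap ∈ shears := by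
  obtain ⟨α, β, v₁, v₂, f, h1, h2, hf, h⟩ := hS
  refine ⟨β, α, v₂, v₁, f, by linarith, by linarith, hf, fun z w => ?_⟩
  simp only [Function.comp, Prod.swap, h]
  rw [add_comm (α • w)]

/-- Apply the upper case to the monoid of swap-conjugates, which again contains the shears. -/
theorem lowerShear_linear_mem (hG : IsMapMonoid G) (hS : shears ⊆ G) (M : ℍ[ℝ] →L[ℝ] ℍ[ℝ]) :
    lowerShear M ∈ G := by
  have hG' : IsMapMonoid {g : QuatPlane → QuatPlane | Prod.swap ∘ g ∘ Prod.swap ∈ G} :=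
    ⟨by
      have : Prod.swap ∘ id ∘ Prod.swap = (id : QuatPlane → QuatPlane) := by ext1 p; simp
      show Prod.swap ∘ id ∘ Prod.swap ∈ G
      rw [this]; exact hG.id_mem, by
      intro f g hf hg
      have := hG.comp_mem hf hg
      show Prod.swap ∘ (f ∘ g) ∘ Prod.swap ∈ G
      convert this using 1
      ext1 p; simp⟩
  have h := upperShear_linear_mem hG' (fun S hSm => hS (swap_conj_mem_shears hSm)) M
  exact h

/-- The linear automorphism `(z, w) ↦ (z + M w, w)`. -/
noncomputable def upperEquiv (M : ℍ[ℝ] →L[ℝ] ℍ[ℝ]) : QuatPlane ≃L[ℝ] QuatPlane :=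
  ContinuousLinearEquiv.equivOfInverse
    ((ContinuousLinearMap.fst ℝ _ _ + M.comp (ContinuousLinearMap.snd ℝ _ _)).prod
      (ContinuousLinearMap.snd ℝ _ _))
    ((ContinuousLinearMap.fst ℝ _ _ - M.comp (ContinuousLinearMap.snd ℝ _ _)).prod
      (ContinuousLinearMap.snd ℝ _ _))
    (fun p => by simp) (fun p => by simp)

/-- The linear automorphism `(z, w) ↦ (z, w + M z)`. -/
noncomputable def lowerEquiv (M : ℍ[ℝ] →L[ℝ] ℍ[ℝ]) : QuatPlane ≃L[ℝ] QuatPlane :=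
  ContinuousLinearEquiv.equivOfInverse
    ((ContinuousLinearMap.fst ℝ _ _).prod
      (ContinuousLinearMap.snd ℝ _ _ + M.comp (ContinuousLinearMap.fst ℝ _ _)))
    ((ContinuousLinearMap.fst ℝ _ _).prod
      (ContinuousLinearMap.snd ℝ _ _ - M.comp (ContinuousLinearMap.fst ℝ _ _)))
    (fun p => by simp) (fun p => by simp)

theorem upperEquiv_apply (M : ℍ[ℝ] →L[ℝ] ℍ[ℝ]) (p : QuatPlane) :
    upperEquiv M p = (p.1 + M p.2, p.2) := rfl

theorem upperEquiv_symm_apply (M : ℍ[ℝ] →L[ℝ] ℍ[ℝ]) (p : QuatPlane) :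
    (upperEquiv M).symm p = (p.1 - M p.2, p.2) := rfl

theorem lowerEquiv_apply (M : ℍ[ℝ] →L[ℝ] ℍ[ℝ]) (p : QuatPlane) :
    lowerEquiv M p = (p.1, p.2 + M p.1) := rfl

theorem lowerEquiv_symm_apply (M : ℍ[ℝ] →L[ℝ] ℍ[ℝ]) (p : QuatPlane) :
    (lowerEquiv M).symm p = (p.1, p.2 - M p.1) := rfl

variable {hG : IsMapMonoid G}

theorem genFields_conj_upperEquiv (hS : shears ⊆ G) {X : QuatPlane → QuatPlane}
    (hX : X ∈ genFields G hG) (M : ℍ[ℝ] →L[ℝ] ℍ[ℝ]) :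
    (fun p => upperEquiv M (X ((upperEquiv M).symm p))) ∈ genFields G hG := by
  refine genFields_conj hX _ (upperShear_linear_mem hG hS M) ?_
  convert upperShear_linear_mem hG hS (-M) using 1
  ext1 p
  simp [upperEquiv_symm_apply, upperShear, sub_eq_add_neg]

theorem genFields_conj_lowerEquiv (hS : shears ⊆ G) {X : QuatPlane → QuatPlane}
    (hX : X ∈ genFields G hG) (M : ℍ[ℝ] →L[ℝ] ℍ[ℝ]) :
    (fun p => lowerEquiv M (X ((lowerEquiv M).symm p))) ∈ genFields G hG := by
  refine genFields_conj hX _ (lowerShear_linear_mem hG hS M) ?_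
  convert lowerShear_linear_mem hG hS (-M) using 1
  ext1 p
  simp [lowerEquiv_symm_apply, lowerShear, sub_eq_add_neg]

theorem upperField_mem_genFields (hS : shears ⊆ G) (n : ℕ) (a : ℍ[ℝ]) :
    (fun p : QuatPlane => (p.2 ^ n * a, (0 : ℍ[ℝ]))) ∈ genFields G hG := by
  have h : ∀ a : ℍ[ℝ], InfGen G (fun p : QuatPlane => (p.2 ^ n * a, (0 : ℍ[ℝ]))) := by
    intro a K _ δ hδ
    filter_upwards [self_mem_nhdsWithin] with h hh
    have hh : 0 < h := hh
    refine ⟨_, hS (upperShear_mem_shears (sliceRegular_pow_mul n (h • a))), fun p _ => ?_⟩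
    have : upperShear (fun q => q ^ n * h • a) p
        - (p + h • (p.2 ^ n * a, (0 : ℍ[ℝ]))) = 0 := by
      ext1 <;> simp [upperShear]
    rw [this, norm_zero]
    positivity
  refine ⟨by fun_prop, h a, ?_⟩
  have h2 := h (-a)
  convert h2 using 1
  ext1 p
  simp

/-- Conjugating `(wⁿ a, 0)` by `w ↦ w - r⁻¹ L z` and scaling by `r^(n + 1)` gives a family that
extends continuously to `r = 0`, where only this field survives. `L` need not be invertible. -/
theorem lowerField_mem_genFields (hS : shears ⊆ G) (n : ℕ) (a : ℍ[ℝ]) (L : ℍ[ℝ] →L[ℝ] ℍ[ℝ]) :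
    (fun p : QuatPlane => ((0 : ℍ[ℝ]), -L (L p.1 ^ n * a))) ∈ genFields G hG := by
  have h := genFields_of_limit (G := G) (hG := hG) (Y := fun r p =>
    (r • ((r • p.2 + L p.1) ^ n * a), -L ((r • p.2 + L p.1) ^ n * a))) (by fun_prop) (by
      intro r hr
      have h1 := (genFields G hG).smul_mem (r ^ (n + 1)) (genFields_conj_lowerEquiv hS
        (upperField_mem_genFields (hG := hG) hS n a) (-(r⁻¹ • L)))
      convert h1 using 1
      ext1 p
      have h2 : r • p.2 + L p.1 = r • (p.2 + r⁻¹ • L p.1) := by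
        rw [smul_add, smul_inv_smul₀ hr]
      rw [h2, smul_pow]
      ext1
      · simp [lowerEquiv_apply, lowerEquiv_symm_apply, pow_succ', smul_smul]
      · simp only [lowerEquiv_apply, lowerEquiv_symm_apply, Pi.smul_apply, Prod.smul_snd,
          neg_apply, smul_apply, sub_neg_eq_add, zero_add,
          smul_mul_assoc, map_smul, smul_neg, smul_smul]
        rw [pow_succ, mul_assoc, mul_inv_cancel₀ hr, mul_one])
  simpa using h

end Shears

/-! ### All real shear fields from quaternionic shears. -/

section ShearFields

open Filter Topology

variable {G : Set (QuatPlane → QuatPlane)} {hG : IsMapMonoid G}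

theorem exists_ne_zero_apply_eq_zero (μ : ℍ[ℝ] →L[ℝ] ℝ) : ∃ v : ℍ[ℝ], v ≠ 0 ∧ μ v = 0 := by
  by_contra! h
  have hinj : Function.Injective (μ : ℍ[ℝ] →ₗ[ℝ] ℝ) := by
    rw [← LinearMap.ker_eq_bot, LinearMap.ker_eq_bot']
    intro v hv
    by_contra hne
    exact h v hne hv
  have := LinearMap.finrank_le_finrank_of_injective hinj
  rw [Quaternion.finrank_eq_four, Module.finrank_self] at this
  omega

/-- The real-linear functional `q ↦ Re(q)`. -/
noncomputable def quatRe : ℍ[ℝ] →L[ℝ] ℝ :=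
  LinearMap.toContinuousLinearMap
    { toFun := fun q => q.re, map_add' := fun _ _ => rfl, map_smul' := fun _ _ => rfl }

@[simp] theorem quatRe_apply (q : ℍ[ℝ]) : quatRe q = q.re := rfl

theorem exists_functional_ne_zero_apply_eq_zero (u : ℍ[ℝ]) :
    ∃ φ : ℍ[ℝ] →L[ℝ] ℝ, φ ≠ 0 ∧ φ u = 0 := by
  obtain ⟨x, hx, h⟩ := exists_ne_zero_apply_eq_zero
    (quatRe.comp (ContinuousLinearMap.mul ℝ ℍ[ℝ] u))
  refine ⟨quatRe.comp ((ContinuousLinearMap.mul ℝ ℍ[ℝ]).flip x), ?_, by simpa using h⟩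
  intro h0
  have h1 := DFunLike.congr_fun h0 x⁻¹
  simp [inv_mul_cancel₀ hx] at h1

theorem exists_apply_eq_one {φ : ℍ[ℝ] →L[ℝ] ℝ} (hφ : φ ≠ 0) : ∃ y, φ y = 1 := by
  obtain ⟨y, hy⟩ := ContinuousLinearMap.exists_ne_zero hφ
  exact ⟨(φ y)⁻¹ • y, by simp [inv_mul_cancel₀ hy]⟩

theorem lowerField_pow_mem_genFields (hS : shears ⊆ G) (n : ℕ) {φ : ℍ[ℝ] →L[ℝ] ℝ} (hφ : φ ≠ 0)
    (v : ℍ[ℝ]) : (fun p : QuatPlane => φ p.1 ^ n • ((0 : ℍ[ℝ]), v)) ∈ genFields G hG := by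
  rcases eq_or_ne v 0 with rfl | hv
  · convert (genFields G hG).zero_mem using 1
    ext1 p
    exact smul_zero _
  obtain ⟨y, hy⟩ := exists_apply_eq_one hφ
  -- With `L = φ · v` the power is `φⁿ vⁿ`; the coefficient cancels `vⁿ` and leaves `y`, which `L`
  -- sends to `v`.
  convert lowerField_mem_genFields (hG := hG) hS n (-((v ^ n)⁻¹ * y)) (φ.smulRight v) using 1
  ext1 p
  have hvn : v ^ n ≠ 0 := pow_ne_zero _ hv
  have h : ((φ p.1) • v) ^ n * -((v ^ n)⁻¹ * y) = -(φ p.1 ^ n • y) := by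
    rw [smul_pow, smul_mul_assoc, mul_neg, mul_inv_cancel_left₀ hvn, smul_neg]
  ext1
  · simp
  · simp only [Prod.smul_snd, ContinuousLinearMap.smulRight_apply]
    rw [h, map_neg, map_smul, hy, neg_smul, neg_neg, smul_eq_mul, mul_one]

theorem field_mem_genFields_of_ne_zero (hS : shears ⊆ G) (n : ℕ) {φ μ : ℍ[ℝ] →L[ℝ] ℝ}
    (hφ : φ ≠ 0) {u v : ℍ[ℝ]} (hv : v ≠ 0) (h : φ u + μ v = 0) :
    (fun p : QuatPlane => (φ p.1 + μ p.2) ^ n • (u, v)) ∈ genFields G hG := by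
  obtain ⟨y, hy⟩ := exists_apply_eq_one hφ
  obtain ⟨κ, hκ⟩ := SeparatingDual.exists_eq_one (R := ℝ) hv
  -- Conjugation needs `M v = u` to tilt the direction and `φ ∘ M = -μ` to tilt the functional; the
  -- two are compatible exactly because `φ u + μ v = 0`.
  set M : ℍ[ℝ] →L[ℝ] ℍ[ℝ] := κ.smulRight u - (μ + φ u • κ).smulRight y with hM
  have hMv : M v = u := by
    simp [hM, hκ, add_comm (μ v), h]
  have hMφ : ∀ w, φ (M w) = -μ w := by
    intro w
    simp [hM, hy]
    ring
  convert genFields_conj_upperEquiv hS (lowerField_pow_mem_genFields (hG := hG) hS n hφ v) M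
    using 1
  ext1 p
  rw [map_smul, upperEquiv_apply, upperEquiv_symm_apply]
  simp only [map_sub, hMφ, hMv, sub_neg_eq_add, zero_add]

theorem linearShearField_mem_genFields_of_ne_zero (hS : shears ⊆ G) (n : ℕ)
    {φ μ : ℍ[ℝ] →L[ℝ] ℝ} (hφ : φ ≠ 0) {u v : ℍ[ℝ]} (h : φ u + μ v = 0) :
    (fun p : QuatPlane => (φ p.1 + μ p.2) ^ n • (u, v)) ∈ genFields G hG := by
  rcases eq_or_ne v 0 with rfl | hv
  · obtain ⟨v', hv', hμ⟩ := exists_ne_zero_apply_eq_zero μ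
    have h1 := field_mem_genFields_of_ne_zero (hG := hG) hS n (μ := μ) hφ (u := u) hv'
      (by rw [hμ]; simpa using h)
    have h2 := field_mem_genFields_of_ne_zero (hG := hG) hS n (μ := μ) hφ (u := 0) hv'
      (by rw [hμ]; simp)
    convert (genFields G hG).sub_mem h1 h2 using 1
    ext1 p
    rw [Pi.sub_apply, ← smul_sub]
    simp
  · exact field_mem_genFields_of_ne_zero hS n hφ hv h

theorem linearShearFields_le_genFields (hS : shears ⊆ G) (n : ℕ) :
    linearShearFields QuatPlane n ≤ genFields G hG := by
  refine Submodule.span_le.2 ?_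
  rintro _ ⟨l, ⟨u, v⟩, h, rfl⟩
  set φ := l.comp (ContinuousLinearMap.inl ℝ ℍ[ℝ] ℍ[ℝ]) with hφ
  set μ := l.comp (ContinuousLinearMap.inr ℝ ℍ[ℝ] ℍ[ℝ]) with hμ
  have hl : ∀ p : QuatPlane, l p = φ p.1 + μ p.2 := fun p => by
    rw [hφ, hμ, ContinuousLinearMap.comp_apply, ContinuousLinearMap.comp_apply, ← map_add]
    simp
  rw [hl] at h
  simp only [hl]
  rcases eq_or_ne φ 0 with h0 | h0
  · obtain ⟨φ', hφ', hu⟩ := exists_functional_ne_zero_apply_eq_zero u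
    have h1 := genFields_of_limit (G := G) (hG := hG) (Y := fun r (p : QuatPlane) =>
      ((r • φ') p.1 + μ p.2) ^ n • (u, v)) (by
        have : Continuous fun q : ℝ × QuatPlane => (q.1 * φ' q.2.1 + μ q.2.2) ^ n • (u, v) := by
          fun_prop
        exact this) (fun r hr =>
        linearShearField_mem_genFields_of_ne_zero hS n (smul_ne_zero hr hφ') (by
          simp only [h0, zero_apply] at h
          simp only [smul_apply, hu, smul_zero]
          exact h))
    simpa [h0] using h1
  · exact linearShearField_mem_genFields_of_ne_zero hS n h0 h

theorem mem_genFields_of_realDiv_eq_zero (hS : shears ⊆ G) {d : ℕ} {X : QuatPlane → QuatPlane}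
    (hX : X ∈ HPoly QuatPlane QuatPlane d) (hdiv : ∀ p, realDiv X p = 0) :
    X ∈ genFields G hG :=
  linearShearFields_le_genFields hS d (mem_linearShearFields_of_realDiv_eq_zero hX hdiv)

end ShearFields

/-! ### Divergence of radial fields and quaternionic traces. -/

section RadialFields

theorem HPoly.smul_self_mem {E : Type*} [NormedAddCommGroup E] [NormedSpace ℝ E]
    [FiniteDimensional ℝ E] {n : ℕ} {H : E → ℝ} (hH : H ∈ HPoly E ℝ n) :
    (fun p => H p • p) ∈ HPoly E E (n + 1) := by
  let b := Module.finBasis ℝ E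
  have h : (fun p => H p • p) = ∑ i, fun p =>
      LinearMap.toContinuousLinearMap (b.coord i) p •
        (ContinuousLinearMap.toSpanSingleton ℝ (b i)) (H p) := by
    funext p
    conv_lhs => rw [← b.sum_repr p]
    rw [Finset.smul_sum, Finset.sum_apply, b.sum_repr p]
    refine Finset.sum_congr rfl fun i _ => ?_
    simp [smul_comm (H p)]
  rw [h]
  exact Submodule.sum_mem _ fun i _ => HPoly.mul_mem _ (HPoly.clm_comp_mem _ hH)

/-- The derivative is `H · id` plus the rank-one map `v ↦ dH(v) p`, whose trace is `n H` by Euler's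
identity. -/
theorem realDiv_smul_self {E : Type*} [NormedAddCommGroup E] [NormedSpace ℝ E]
    [FiniteDimensional ℝ E] {n : ℕ} {H : E → ℝ} (hH : H ∈ HPoly E ℝ n) (p : E) :
    realDiv (fun p => H p • p) p = (Module.finrank ℝ E + n) * H p := by
  have h1 : HasFDerivAt (fun p => H p • p) _ p :=
    ((HPoly.differentiable hH p).hasFDerivAt).smul (hasFDerivAt_id p)
  let b := Module.finBasis ℝ E
  rw [realDiv, h1.fderiv, trace_eq_sum_coord b]
  have h2 : ∑ i, b.coord i p • fderiv ℝ H p (b i) = n * H p := by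
    rw [← smul_eq_mul (n : ℝ), ← HPoly.fderiv_self hH p]
    simpa only [map_sum, map_smul, Module.Basis.coord_apply] using
      congrArg (fderiv ℝ H p) (b.sum_repr p)
  rw [add_mul, ← h2]
  simp [Finset.sum_add_distrib, mul_comm]

theorem realDiv_sub_smul {E : Type*} [NormedAddCommGroup E] [NormedSpace ℝ E]
    [FiniteDimensional ℝ E] {X Y : E → E} (hX : Differentiable ℝ X) (hY : Differentiable ℝ Y)
    (c : ℝ) (p : E) : realDiv (X - c • Y) p = realDiv X p - c * realDiv Y p := by
  rw [realDiv, fderiv_sub (hX p) ((hY p).const_smul c), fderiv_const_smul (hY p)]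
  simp [realDiv]

theorem realDiv_eq_sum {ι : Type*} [Fintype ι] (b : Module.Basis ι ℝ ℍ[ℝ])
    (X : QuatPlane → QuatPlane) (p : QuatPlane) :
    realDiv X p = ∑ i, b.coord i ((fderiv ℝ X p (b i, 0)).1 + (fderiv ℝ X p (0, b i)).2) := by
  rw [realDiv, trace_eq_sum_coord (b.prod b), Fintype.sum_sum_type, ← Finset.sum_add_distrib]
  refine Finset.sum_congr rfl fun i _ => ?_
  simp

/-- The basis `1, i, j, k` of the quaternions. -/
noncomputable def quatBasis : Module.Basis (Fin 4) ℝ ℍ[ℝ] :=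
  QuaternionAlgebra.basisOneIJK (-1 : ℝ) 0 (-1)

theorem quatBasis_repr (q : ℍ[ℝ]) : ⇑(quatBasis.repr q) = ![q.re, q.imI, q.imJ, q.imK] := rfl

theorem quatBasis_eq : ⇑quatBasis = ![1, quatI, quatJ, quatK] := by
  funext i
  apply quatBasis.repr.injective
  rw [Module.Basis.repr_self]
  ext j
  rw [quatBasis_repr]
  fin_cases i <;> fin_cases j <;> simp

/-- The trace of right multiplication, which is the `z`-derivative of an overshear field. -/
theorem sum_coord_mul_right (c : ℍ[ℝ]) :
    ∑ i, quatBasis.coord i (quatBasis i * c) = 4 * c.re := by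
  simp only [Module.Basis.coord_apply, quatBasis_repr, quatBasis_eq, Fin.sum_univ_four]
  simp
  ring

end RadialFields

/-! ### Fields generated by overshears. -/

section OvershearFields

open Filter Topology

variable {G : Set (QuatPlane → QuatPlane)} {hG : IsMapMonoid G}

/-- Take the overshear with exponent `x = h wⁿ a` and use `e^x - 1 = x + o(x)`, uniformly since `x`
is `O(h)` on `K`. -/
theorem infGen_overshear (hO : overshears ⊆ G) (n : ℕ) (a : ℍ[ℝ]) :
    InfGen G (fun p : QuatPlane => (p.1 * (p.2 ^ n * a), (0 : ℍ[ℝ]))) := by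
  intro K hK δ hδ
  obtain ⟨A, hA⟩ := hK.exists_bound_of_continuousOn
    (f := fun p : QuatPlane => p.1) continuous_fst.continuousOn
  obtain ⟨B, hB⟩ := hK.exists_bound_of_continuousOn
    (f := fun p : QuatPlane => p.2 ^ n * a) (by fun_prop)
  set c : ℝ := δ / ((|A| + 1) * (|B| + 1)) with hc
  have hc0 : 0 < c := by positivity
  have hexp : ∀ᶠ x : ℍ[ℝ] in 𝓝 0, ‖NormedSpace.exp x - 1 - x‖ ≤ c * ‖x‖ := by
    have h1 := (hasFDerivAt_exp_zero (𝕂 := ℝ) (𝔸 := ℍ[ℝ])).isLittleO.def hc0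
    filter_upwards [h1] with x hx
    simpa [NormedSpace.exp_zero] using hx
  obtain ⟨η, hη, hexp⟩ := Metric.eventually_nhds_iff.1 hexp
  have hsmall : ∀ᶠ h : ℝ in 𝓝[>] 0, h * (|B| + 1) < η := by
    have : Tendsto (fun h : ℝ => h * (|B| + 1)) (𝓝[>] 0) (𝓝 (0 * (|B| + 1))) := by
      apply Tendsto.mono_left _ nhdsWithin_le_nhds
      exact Continuous.tendsto (by fun_prop) _
    exact this.eventually_lt_const (by simpa using hη)
  filter_upwards [hsmall, self_mem_nhdsWithin] with h hs hpos
  have hpos : 0 < h := hpos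
  refine ⟨fun p => (p.1 + p.1 * (NormedSpace.exp (p.2 ^ n * (h • a)) - 1), p.2),
    hO ⟨0, 1, 1, 0, fun q => q ^ n * (h • a), by norm_num, by norm_num,
      sliceRegular_pow_mul n _, fun z w => by simp⟩, fun p hp => ?_⟩
  have hx : ‖h • (p.2 ^ n * a)‖ ≤ h * (|B| + 1) := by
    rw [norm_smul, Real.norm_of_nonneg hpos.le]
    gcongr
    linarith [hB p hp, le_abs_self B]
  have he := hexp (y := h • (p.2 ^ n * a)) (by
    rw [dist_zero_right]
    exact hx.trans_lt hs)
  have heq : (p.1 + p.1 * (NormedSpace.exp (p.2 ^ n * (h • a)) - 1), p.2)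
      - (p + h • (p.1 * (p.2 ^ n * a), (0 : ℍ[ℝ]))) =
      (p.1 * (NormedSpace.exp (h • (p.2 ^ n * a)) - 1 - h • (p.2 ^ n * a)), 0) := by
    ext1
    · simp only [Prod.fst_sub, Prod.fst_add, Prod.smul_fst, mul_sub, mul_smul_comm]
      abel
    · simp
  rw [heq, Prod.norm_mk, norm_zero, max_eq_left (norm_nonneg _)]
  calc ‖p.1 * (NormedSpace.exp (h • (p.2 ^ n * a)) - 1 - h • (p.2 ^ n * a))‖
      ≤ (|A| + 1) * (c * (h * (|B| + 1))) := by
        refine (norm_mul_le _ _).trans ?_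
        gcongr
        · linarith [hA p hp, le_abs_self A]
        · exact he.trans (by gcongr)
    _ = δ * h := by rw [hc]; field_simp

theorem overshearField_mem_genFields (hO : overshears ⊆ G) (n : ℕ) (a : ℍ[ℝ]) :
    (fun p : QuatPlane => (p.1 * (p.2 ^ n * a), (0 : ℍ[ℝ]))) ∈ genFields G hG := by
  refine ⟨by fun_prop, infGen_overshear hO n a, ?_⟩
  convert infGen_overshear hO n (-a) using 1
  ext1 p
  simp

theorem snd_pow_mul_mem (n : ℕ) (a : ℍ[ℝ]) :
    (fun p : QuatPlane => p.2 ^ n * a) ∈ HPoly QuatPlane ℍ[ℝ] n := by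
  induction n with
  | zero => simpa using HPoly.pow_smul_mem 0 (0 : QuatPlane →L[ℝ] ℝ) a
  | succ n ih =>
    refine (congrArg (· ∈ HPoly QuatPlane ℍ[ℝ] (n + 1)) ?_).mp
      (quaternion_mul_mem (ContinuousLinearMap.snd ℝ ℍ[ℝ] ℍ[ℝ]) ih)
    funext p
    simp [pow_succ', mul_assoc]

theorem overshearField_mem (n : ℕ) (a : ℍ[ℝ]) :
    (fun p : QuatPlane => (p.1 * (p.2 ^ n * a), (0 : ℍ[ℝ]))) ∈
      HPoly QuatPlane QuatPlane (n + 1) :=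
  HPoly.clm_comp_mem (ContinuousLinearMap.inl ℝ ℍ[ℝ] ℍ[ℝ])
    (quaternion_mul_mem (ContinuousLinearMap.fst ℝ ℍ[ℝ] ℍ[ℝ]) (snd_pow_mul_mem n a))

theorem realDiv_overshearField (n : ℕ) (a : ℍ[ℝ]) (p : QuatPlane) :
    realDiv (fun p : QuatPlane => (p.1 * (p.2 ^ n * a), (0 : ℍ[ℝ]))) p
      = 4 * (p.2 ^ n * a).re := by
  obtain ⟨D, hD⟩ : ∃ D : ℍ[ℝ] →L[ℝ] ℍ[ℝ], HasFDerivAt (fun w : ℍ[ℝ] => w ^ n * a) D p.2 :=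
    ⟨_, (by fun_prop : Differentiable ℝ fun w : ℍ[ℝ] => w ^ n * a) p.2 |>.hasFDerivAt⟩
  have h1 : HasFDerivAt (fun p : QuatPlane => p.1) (ContinuousLinearMap.fst ℝ ℍ[ℝ] ℍ[ℝ]) p :=
    hasFDerivAt_fst
  have h2 : HasFDerivAt (fun p : QuatPlane => p.2 ^ n * a)
      (D.comp (ContinuousLinearMap.snd ℝ ℍ[ℝ] ℍ[ℝ])) p := hD.comp p hasFDerivAt_snd
  have h3 : HasFDerivAt (fun p : QuatPlane => (p.1 * (p.2 ^ n * a), (0 : ℍ[ℝ]))) _ p :=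
    (h1.mul' h2).prodMk (hasFDerivAt_const (0 : ℍ[ℝ]) p)
  rw [realDiv_eq_sum quatBasis, h3.fderiv, ← sum_coord_mul_right]
  refine Finset.sum_congr rfl fun i _ => ?_
  simp

theorem radial_pow_mem_genFields_aux (hS : shears ⊆ G) (hO : overshears ⊆ G) (n : ℕ) (a : ℍ[ℝ]) :
    (fun p : QuatPlane => (p.2 ^ n * a).re • p) ∈ genFields G hG := by
  set H : QuatPlane → ℝ := fun p => (p.2 ^ n * a).re with hH
  have hHm : H ∈ HPoly QuatPlane ℝ n := HPoly.clm_comp_mem quatRe (snd_pow_mul_mem n a)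
  set Y : QuatPlane → QuatPlane := fun p => (p.1 * (p.2 ^ n * a), 0) with hY
  have hYm : Y ∈ HPoly QuatPlane QuatPlane (n + 1) := overshearField_mem n a
  have hR := HPoly.smul_self_mem hHm
  -- The ratio of the two divergences: the radial field has `(dim + n) H`, the overshear field `4
  -- H`. Their difference is handled by shears.
  set c : ℝ := (Module.finrank ℝ QuatPlane + n) / 4 with hc
  have h1 : (fun p => H p • p) - c • Y ∈ genFields G hG := by
    refine mem_genFields_of_realDiv_eq_zero hS (Submodule.sub_mem _ hR
      (Submodule.smul_mem _ c hYm)) fun p => ?_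
    rw [realDiv_sub_smul (HPoly.differentiable hR) (HPoly.differentiable hYm),
      realDiv_smul_self hHm, realDiv_overshearField, hc, hH]
    ring
  have h2 := (genFields G hG).add_mem h1
    ((genFields G hG).smul_mem c (overshearField_mem_genFields (hG := hG) hO n a))
  rwa [sub_add_cancel] at h2

/-- Linear maps preserve the Euler field `p ↦ p`, so conjugation acts on the coefficient alone. -/
theorem radial_conj (T : QuatPlane ≃L[ℝ] QuatPlane) (H : QuatPlane → ℝ) (p : QuatPlane) :
    T (H (T.symm p) • T.symm p) = H (T.symm p) • p := by
  rw [map_smul, T.apply_symm_apply]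

/-- Conjugation turns `Re(wⁿ)` into `Re((r w + φ(z))ⁿ)` up to scale; at `r = 0` this is the real
number `φ(z)ⁿ`. -/
theorem radial_lower_mem_genFields (hS : shears ⊆ G) (hO : overshears ⊆ G) (n : ℕ)
    (φ : ℍ[ℝ] →L[ℝ] ℝ) : (fun p : QuatPlane => φ p.1 ^ n • p) ∈ genFields G hG := by
  set L : ℍ[ℝ] →L[ℝ] ℍ[ℝ] := φ.smulRight 1 with hL
  have h := genFields_of_limit (G := G) (hG := hG) (Y := fun r (p : QuatPlane) =>
    quatRe ((r • p.2 + L p.1) ^ n) • p) (by fun_prop) (by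
      intro r hr
      have h1 := (genFields G hG).smul_mem (r ^ n) (genFields_conj_lowerEquiv hS
        (radial_pow_mem_genFields_aux (hG := hG) hS hO n 1) (-(r⁻¹ • L)))
      convert h1 using 1
      ext1 p
      have h2 : r • p.2 + L p.1 = r • (p.2 + r⁻¹ • L p.1) := by
        rw [smul_add, smul_inv_smul₀ hr]
      rw [h2, smul_pow, Pi.smul_apply,
        radial_conj (lowerEquiv (-(r⁻¹ • L))) fun p => (p.2 ^ n * 1).re,
        lowerEquiv_symm_apply, smul_smul]
      simp)
  convert h using 1
  ext1 p
  simp only [hL, zero_smul, zero_add, ContinuousLinearMap.smulRight_apply, smul_pow, one_pow]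
  simp

theorem radial_pow_mem_genFields (hS : shears ⊆ G) (hO : overshears ⊆ G) (n : ℕ)
    (l : QuatPlane →L[ℝ] ℝ) : (fun p : QuatPlane => l p ^ n • p) ∈ genFields G hG := by
  set φ := l.comp (ContinuousLinearMap.inl ℝ ℍ[ℝ] ℍ[ℝ]) with hφ
  set μ := l.comp (ContinuousLinearMap.inr ℝ ℍ[ℝ] ℍ[ℝ]) with hμ
  have hl : ∀ p : QuatPlane, l p = φ p.1 + μ p.2 := fun p => by
    rw [hφ, hμ, ContinuousLinearMap.comp_apply, ContinuousLinearMap.comp_apply, ← map_add]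
    simp
  simp only [hl]
  have key : ∀ φ : ℍ[ℝ] →L[ℝ] ℝ, φ ≠ 0 →
      (fun p : QuatPlane => (φ p.1 + μ p.2) ^ n • p) ∈ genFields G hG := by
    intro φ hφ
    obtain ⟨y, hy⟩ := exists_apply_eq_one hφ
    convert genFields_conj_upperEquiv hS (radial_lower_mem_genFields (hG := hG) hS hO n φ)
      (-(μ.smulRight y)) using 1
    ext1 p
    rw [radial_conj (upperEquiv (-(μ.smulRight y))) fun p => φ p.1 ^ n, upperEquiv_symm_apply]
    simp [hy]
  rcases eq_or_ne φ 0 with h0 | h0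
  · obtain ⟨φ', hφ', _⟩ := exists_functional_ne_zero_apply_eq_zero 0
    have h1 := genFields_of_limit (G := G) (hG := hG) (Y := fun r (p : QuatPlane) =>
      ((r • φ') p.1 + μ p.2) ^ n • p) (by
        have : Continuous fun q : ℝ × QuatPlane => (q.1 * φ' q.2.1 + μ q.2.2) ^ n • q.2 := by
          fun_prop
        exact this) (fun r hr => key _ (smul_ne_zero hr hφ'))
    simpa [h0] using h1
  · exact key φ h0

theorem radial_mem_genFields (hS : shears ⊆ G) (hO : overshears ⊆ G) {n : ℕ}
    {H : QuatPlane → ℝ} (hH : H ∈ HPoly QuatPlane ℝ n) :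
    (fun p => H p • p) ∈ genFields G hG := by
  induction hH using Submodule.span_induction with
  | mem f hf =>
    obtain ⟨l, c, rfl⟩ := hf
    convert (genFields G hG).smul_mem c (radial_pow_mem_genFields (hG := hG) hS hO n l) using 1
    ext1 p
    simp only [Pi.smul_apply, smul_smul, smul_eq_mul, mul_comm]
  | zero =>
    convert (genFields G hG).zero_mem using 1
    ext1 p
    exact zero_smul _ _
  | add f g _ _ hf hg =>
    convert (genFields G hG).add_mem hf hg using 1
    ext1 p
    exact add_smul _ _ _
  | smul c f _ hf =>
    convert (genFields G hG).smul_mem c hf using 1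
    ext1 p
    simp only [Pi.smul_apply, smul_assoc]

/-- Subtracting the radial field with coefficient `div X / (dim + n)`, where `n` is the degree of
`div X`, leaves a divergence-free field, which shears generate. -/
theorem hPoly_le_genFields (hS : shears ⊆ G) (hO : overshears ⊆ G) (d : ℕ) :
    HPoly QuatPlane QuatPlane d ≤ genFields G hG := by
  rcases d with _ | n
  · refine le_trans (Submodule.span_le.2 ?_) (linearShearFields_le_genFields hS 0)
    rintro _ ⟨l, e, rfl⟩
    exact Submodule.subset_span ⟨0, e, rfl, by simp only [pow_zero]⟩
  intro X hX
  have hH : realDiv X ∈ HPoly QuatPlane ℝ n := realDiv_mem (d := n + 1) hX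
  set N : ℝ := Module.finrank ℝ QuatPlane + n with hN
  have hN0 : N ≠ 0 := by
    have h0 : 0 < Module.finrank ℝ QuatPlane := Module.finrank_pos
    exact (add_pos_of_pos_of_nonneg (Nat.cast_pos.2 h0) (Nat.cast_nonneg n)).ne'
  have hR := HPoly.smul_self_mem hH
  have h1 : X - N⁻¹ • (fun p => realDiv X p • p) ∈ genFields G hG := by
    refine mem_genFields_of_realDiv_eq_zero hS (Submodule.sub_mem _ hX
      (Submodule.smul_mem _ _ hR)) fun p => ?_
    rw [realDiv_sub_smul (HPoly.differentiable hX) (HPoly.differentiable hR),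
      realDiv_smul_self hH, ← hN, inv_mul_cancel_left₀ hN0, sub_self]
  have h2 := (genFields G hG).add_mem h1
    ((genFields G hG).smul_mem N⁻¹ (radial_mem_genFields (hG := hG) hS hO hH))
  rwa [sub_add_cancel] at h2

end OvershearFields

/-! ### Assembly of the theorem. -/

section Main

theorem exists_homogeneousExpansion {X : QuatPlane → QuatPlane} (hX : X ∈ quatVectorFields) :
    ∃ F : ℕ → QuatPlane → QuatPlane, IsHomogeneousExpansion F X := by
  obtain ⟨⟨A, hA, hA'⟩, B, hB, hB'⟩ := hX
  refine ⟨fun d p => (A d p, B d p), fun d => ?_, fun p => ?_, fun p => ?_⟩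
  · have h1 := HPoly.clm_comp_mem (ContinuousLinearMap.inl ℝ ℍ[ℝ] ℍ[ℝ])
      (homogeneousPoly_le d (hA d))
    have h2 := HPoly.clm_comp_mem (ContinuousLinearMap.inr ℝ ℍ[ℝ] ℍ[ℝ])
      (homogeneousPoly_le d (hB d))
    refine (congrArg (· ∈ HPoly QuatPlane QuatPlane d) ?_).mp (Submodule.add_mem _ h1 h2)
    funext p
    simp
  · refine Summable.of_nonneg_of_le (fun d => norm_nonneg _) (fun d => ?_)
      ((hA' p).1.add (hB' p).1)
    exact max_le_add_of_nonneg (norm_nonneg _) (norm_nonneg _)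
  · exact (hA' p).2.prodMk (hB' p).2

theorem quatDiv_eq {X : QuatPlane → QuatPlane} {p : QuatPlane} (hX : DifferentiableAt ℝ X p)
    (h : ℍ[ℝ]) : quatDiv X p h = (fderiv ℝ X p (h, 0)).1 + (fderiv ℝ X p (0, h)).2 := by
  have h1 : HasFDerivAt (fun z => (X (z, p.2)).1) ((ContinuousLinearMap.fst ℝ ℍ[ℝ] ℍ[ℝ]).comp
      ((fderiv ℝ X p).comp (ContinuousLinearMap.inl ℝ ℍ[ℝ] ℍ[ℝ]))) p.1 :=
    hasFDerivAt_fst.comp p.1 (hX.hasFDerivAt.comp p.1 (hasFDerivAt_prodMk_left p.1 p.2))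
  have h2 : HasFDerivAt (fun w => (X (p.1, w)).2) ((ContinuousLinearMap.snd ℝ ℍ[ℝ] ℍ[ℝ]).comp
      ((fderiv ℝ X p).comp (ContinuousLinearMap.inr ℝ ℍ[ℝ] ℍ[ℝ]))) p.2 :=
    hasFDerivAt_snd.comp p.2 (hX.hasFDerivAt.comp p.2 (hasFDerivAt_prodMk_right p.1 p.2))
  rw [quatDiv, partialZ, partialW, h1.fderiv, h2.fderiv]
  simp

theorem IsHomogeneousExpansion.approxOnCompacts {F : ℕ → QuatPlane → QuatPlane}
    {X Ψ : QuatPlane → QuatPlane} (h : IsHomogeneousExpansion F X)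
    {G : Set (QuatPlane → QuatPlane)} (hG : IsMapMonoid G) (hF : ∀ d, F d ∈ genFields G hG)
    (hΨ : IsTimeOneMap X Ψ) : ApproxOnCompacts Ψ G := by
  obtain ⟨D, Φ, hΦ, hD, hΨ⟩ := hΨ
  have hgen : X ∈ genFields G hG := genFields_of_approx h.continuous fun K hK ε hε => by
    obtain ⟨n, hn⟩ := h.exists_partial_sum hK hε
    exact ⟨_, Submodule.sum_mem _ fun d _ => hF d, hn⟩
  intro K hK ε hε
  obtain ⟨g, hg, h1⟩ := hgen.2.1.approx_timeOne hG h.exists_lipschitzOnWith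
    (γ := fun p t => Φ (p, t)) hΦ.initial
    (fun p t ht => hΦ.deriv p t ((hΦ.interval p).out (hΦ.zero_mem p) (hD p) ht)) hK hε
  exact ⟨g, hg, fun p hp => by rw [hΨ]; exact h1 p hp⟩

theorem mainTheorem3 :
    (∀ F ∈ AutV, ApproxOnCompacts F (finiteCompositions (shears ∪ overshears))) ∧
      (∀ F ∈ Aut1, ApproxOnCompacts F (finiteCompositions shears)) := by
  constructor
  · rintro Ψ ⟨X, hX, -, hΨ⟩
    obtain ⟨F, hF⟩ := exists_homogeneousExpansion hX
    have hsub := subset_finiteCompositions (shears ∪ overshears)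
    exact hF.approxOnCompacts (isMapMonoid_finiteCompositions _) (fun d =>
      hPoly_le_genFields (Set.subset_union_left.trans hsub) (Set.subset_union_right.trans hsub) d
        (hF.mem d)) hΨ
  · rintro Ψ ⟨X, hX, hdiv, hΨ⟩
    obtain ⟨F, hF⟩ := exists_homogeneousExpansion hX
    refine hF.approxOnCompacts (isMapMonoid_finiteCompositions _) (fun d =>
      mem_genFields_of_realDiv_eq_zero (subset_finiteCompositions _) (hF.mem d)
        (hF.realDiv_eq_zero (fun p => ?_) d)) hΨ
    -- The real divergence is the trace of `h ↦ Div X(p)[h]`.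
    rw [realDiv_eq_sum quatBasis]
    refine Finset.sum_eq_zero fun i _ => ?_
    rw [← quatDiv_eq (hF.hasFDerivAt p).differentiableAt, hdiv, map_zero]

end Main
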